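/- Let $d\ge 1$ and let $T\subset\mathbb R^d$ be a nondegenerate $d$-simplex with barycentric coordinates $\lambda_0,\dots,\lambda_d$. A subsimplex $f$ of dimension $\ell$ is identified with its set of $\ell+1$ vertex indices; $\Delta_\ell(T)$ is the set of these, $\mathscr T^f\subseteq\mathbb R^d$ is the tangent space of $f$, and $b_f=\prod_{i\in f}\lambda_i$. For $m\in\mathbb Z$ let $\mathbb P_m(f)=\operatorname{span}\{\prod_{i\in f}\lambda_i^{\alpha_i} : \alpha_i\in\mathbb N,\ \sum_{i\in f}\alpha_i=m\}$ (polynomials on $f$ of degree $\le m$, extended to $T$ by the barycentric coordinates), so that $\mathbb P_m(f)=\{0\}$ for $m<0$. Let $\star:\operatorname{Alt}^{d-k}(\mathbb R^d)\to\operatorname{Alt}^{k}(\mathbb R^d)$ be the Hodge star, and regard $\operatorname{Alt}^{d-k}(\mathscr T^f)$ as a subspace of $\operatorname{Alt}^{d-k}(\mathbb R^d)$ by pullback along the orthogonal projection $\mathbb R^d\to\mathscr T^f$. For $0\le k\le d$ and $r\in\mathbb Z$ define the space of bubble polynomial $k$-forms $$\mathbb B_r\Lambda^k(T)=\sum_{\ell=d-k}^{d}\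 \sum_{f\in\Delta_\ell(T)} \mathbb P_{r-(\ell+1)}(f)\otimes b_f\,\star\operatorname{Alt}^{d-k}(\mathscr T^f).$$ Then for all integers $r$ and $0\le k\le d$ the sequence $$0\to \mathbb B_{r+k}\Lambda^0(T)\xrightarrow{d}\cdots\xrightarrow{d}\mathbb B_r\Lambda^k(T)\xrightarrow{d}\mathbb B_{r-1}\Lambda^{k+1}(T)\xrightarrow{d}\cdots\xrightarrow{d}\mathbb B_{r+k-d}\Lambda^d(T)\xrightarrow{\int_T}\mathbb R$$ is a well-defined complex and is exact: with $s=r+k$, the map $d$ is injective on $\mathbb B_s\Lambda^0(T)$; $d\,\mathbb B_{s-j}\Lambda^j(T)=\mathbb B_{s-j-1}\Lambda^{j+1}(T)\cap\ker d$ for $0\le j\le d-2$; and $d\,\mathbb B_{s-d+1}\Lambda^{d-1}(T)=\{\omega\in\mathbb B_{s-d}\Lambda^d(T):\int_T\omega=0\}$. Moreover, $\int_T:\mathbb B_{s-d}\Lambda^d(T)\to\mathbb R$ is onto when $s-d\ge 1$. -/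

import Mathlib

open MeasureTheory

noncomputable section

namespace BubbleComplex

/-- The ambient Euclidean space `ℝ^d`. -/
abbrev E (d : ℕ) : Type := EuclideanSpace ℝ (Fin d)

/-- The exterior `k`-forms `Alt^k(ℝ^d)` (on a finite-dimensional space every alternating
multilinear form is continuous). -/
abbrev Alt (d k : ℕ) : Type := E d [⋀^Fin k]→L[ℝ] ℝ

/-- Differential `k`-forms. A polynomial form on a full-dimensional simplex is identified with its
polynomial coefficients, hence with a form on all of `ℝ^d`. -/
abbrev Form (d k : ℕ) : Type := E d → Alt d k

section HodgeStar

variable {d m k : ℕ}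

/-- The list `(u, v)` of `d = m + k` vectors. -/
def join (h : m + k = d) (u : Fin m → E d) (v : Fin k → E d) : Fin d → E d :=
  fun i => Fin.append u v (Fin.cast h.symm i)

lemma join_update (h : m + k = d) (u : Fin m → E d) (v : Fin k → E d) [DecidableEq (Fin k)]
    (i : Fin k) (x : E d) :
    join h u (Function.update v i x)
      = Function.update (join h u v) (Fin.cast h (Fin.natAdd m i)) x := by
  subst h
  funext j
  refine Fin.addCases (fun a => ?_) (fun a => ?_) j
  · have hne : Fin.castAdd k a ≠ Fin.natAdd m i := by
      intro h'
      have := congrArg Fin.val h'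
      simp at this
      omega
    simp [join, Function.update_of_ne hne]
  · by_cases hai : a = i
    · subst hai
      simp [join]
    · have hne : Fin.natAdd m a ≠ Fin.natAdd m i := by
        intro h'
        exact hai (by simpa using h')
      simp [join, Function.update_of_ne hne, Function.update_of_ne hai]

/-- `dx(u_1, …, u_m, · , …, ·) ∈ Alt^k(ℝ^d)`, where `dx = dx_1 ∧ ⋯ ∧ dx_d` is the positive volume
form of `ℝ^d`, that is, the determinant of the coordinates of its `d = m + k` arguments. -/
def volContract (h : m + k = d) (u : Fin m → E d) : Alt d k where
  toFun v := Matrix.det (Matrix.of fun i j => join h u v i j)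
  map_update_add' v i x y := by
    have key : ∀ z : E d, (Matrix.of fun a b => join h u (Function.update v i z) a b)
        = Matrix.updateRow (Matrix.of fun a b => join h u v a b)
            (Fin.cast h (Fin.natAdd m i)) (fun b => z b) := by
      intro z
      ext a b
      rw [join_update]
      by_cases hab : a = Fin.cast h (Fin.natAdd m i)
      · subst hab; simp
      · simp [Matrix.updateRow_ne hab, Function.update_of_ne hab]
    rw [key, key, key]
    exact Matrix.det_updateRow_add _ _ _ _
  map_update_smul' v i c x := by
    have key : ∀ z : E d, (Matrix.of fun a b => join h u (Function.update v i z) a b)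
        = Matrix.updateRow (Matrix.of fun a b => join h u v a b)
            (Fin.cast h (Fin.natAdd m i)) (fun b => z b) := by
      intro z
      ext a b
      rw [join_update]
      by_cases hab : a = Fin.cast h (Fin.natAdd m i)
      · subst hab; simp
      · simp [Matrix.updateRow_ne hab, Function.update_of_ne hab]
    rw [key, key]
    exact Matrix.det_updateRow_smul _ _ _ _
  map_eq_zero_of_eq' v i j hij hne := by
    refine Matrix.det_zero_of_row_eq (i := Fin.cast h (Fin.natAdd m i))
      (j := Fin.cast h (Fin.natAdd m j)) ?_ ?_
    · intro h'
      apply hne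
      have := congrArg Fin.val h'
      ext
      simpa using this
    · funext b
      simp [join, hij]
  cont := by
    refine Continuous.matrix_det ?_
    refine continuous_matrix fun a b => ?_
    subst h
    refine Fin.addCases (fun c => ?_) (fun c => ?_) a
    · simp only [Matrix.of_apply, join, Fin.cast_eq_self, Fin.append_left]
      exact continuous_const
    · simp only [Matrix.of_apply, join, Fin.cast_eq_self, Fin.append_right]
      fun_prop

/-- The standard basis vectors `(e_{σ(1)}, …, e_{σ(m)})`. -/
def stdVec (σ : Fin m → Fin d) : Fin m → E d := fun i => EuclideanSpace.single (σ i) 1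

/-- The Hodge star `⋆ : Alt^m(ℝ^d) → Alt^k(ℝ^d)`, `m + k = d`, for the standard inner product and
orientation: with `σ` running over the increasing sequences,
`⋆ (∑ a_σ dx_σ) = ∑ a_σ ⋆ dx_σ`, where `a_σ = ω(e_σ)` and
`⋆ dx_σ = dx(e_σ, · ) = sign(σ, σᶜ) dx_{σᶜ}`. -/
def hodgeStar (h : m + k = d) (ω : Alt d m) : Alt d k :=
  ∑ σ : Fin m ↪o Fin d, ω (stdVec σ) • volContract h (stdVec σ)

end HodgeStar

section Simplex

variable {d : ℕ}

/-- The vertices of a `d`-simplex in `ℝ^d` as an affine basis of `ℝ^d`. -/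
def vertexBasis (T : Affine.Simplex ℝ (E d) d) : AffineBasis (Fin (d + 1)) ℝ (E d) :=
  ⟨T.points, T.independent,
    T.independent.affineSpan_eq_top_iff_card_eq_finrank_add_one.2 (by simp)⟩

/-- The barycentric coordinate `λ_i` of `T`. -/
def bary (T : Affine.Simplex ℝ (E d) d) (i : Fin (d + 1)) (x : E d) : ℝ :=
  (vertexBasis T).coord i x

/-- A subsimplex is given by its set of vertices `f`; this is its bubble polynomial
`b_f = ∏_{i ∈ f} λ_i`. -/
def faceBubble (T : Affine.Simplex ℝ (E d) d) (f : Finset (Fin (d + 1))) (x : E d) : ℝ :=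
  ∏ i ∈ f, bary T i x

/-- The space `ℙ_m(f)` in Bernstein form, extended to `ℝ^d` by the barycentric coordinates:
the span of the `λ_f^α = ∏_{i ∈ f} λ_i^{α_i}` with `∑_{i ∈ f} α_i = m`.
It is `{0}` for negative `m`. -/
def facePoly (T : Affine.Simplex ℝ (E d) d) (f : Finset (Fin (d + 1))) (m : ℤ) :
    Submodule ℝ (E d → ℝ) :=
  Submodule.span ℝ {p | ∃ α : Fin (d + 1) → ℕ, ((∑ i ∈ f, α i : ℕ) : ℤ) = m ∧
    p = fun x => ∏ i ∈ f, bary T i x ^ α i}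

/-- The tangent space `𝒯^f` of the subsimplex with vertex set `f`. -/
def tangentSpace (T : Affine.Simplex ℝ (E d) d) (f : Finset (Fin (d + 1))) :
    Submodule ℝ (E d) :=
  vectorSpan ℝ (T.points '' (f : Set (Fin (d + 1))))

/-- The embedding `Π_f^* : Alt^m(𝒯^f) → Alt^m(ℝ^d)`, the pullback by the orthogonal projection
`Π_f : ℝ^d → 𝒯^f`. -/
def extendAlt (T : Affine.Simplex ℝ (E d) d) (f : Finset (Fin (d + 1))) {m : ℕ}
    (η : tangentSpace T f [⋀^Fin m]→L[ℝ] ℝ) : Alt d m :=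
  η.compContinuousLinearMap (tangentSpace T f).orthogonalProjectionOnto

/-- The bubble space `𝔹_r Λ^k(T)`, `0 ≤ k ≤ d`: the sum, over the subsimplices `f` of `T` of
dimension `ℓ = #f - 1` with `d - k ≤ ℓ ≤ d`, of
`ℙ_{r-(ℓ+1)}(f) ⊗ b_f ⋆ Alt^{d-k}(𝒯^f)`. -/
def bubble (T : Affine.Simplex ℝ (E d) d) (r : ℤ) (k : ℕ) (hk : k ≤ d) :
    Submodule ℝ (Form d k) :=
  ⨆ f : {f : Finset (Fin (d + 1)) // d - k + 1 ≤ f.card},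
    Submodule.span ℝ {ω : Form d k | ∃ p ∈ facePoly T f.1 (r - (f.1.card : ℤ)),
      ∃ η : tangentSpace T f.1 [⋀^Fin (d - k)]→L[ℝ] ℝ,
        ω = fun x => (p x * faceBubble T f.1 x) •
          hodgeStar (Nat.sub_add_cancel hk) (extendAlt T f.1 η)}

/-- The integral `∫_T ω` of a `d`-form `ω = a dx`, `a = ω(e_1, …, e_d)`. -/
def integral (T : Affine.Simplex ℝ (E d) d) (ω : Form d d) : ℝ :=
  ∫ x in convexHull ℝ (Set.range T.points), ω x (stdVec id)

end Simplex

end BubbleComplex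

end

/-! A form in the bubble space of degree `r` is a Bernstein sum `∑ λ^α a_α` over `|α| = r`, and
membership says exactly that `dλ_i ∧ a_α = 0` whenever `α_i = 0` (`bubble_eq_map`). The reason is
that the forms `⋆ η`, with `η` coming from a face `f`, are those annihilated by all `dλ_i` with `i ∉
f` (`exists_hodgeStar_extendAlt_iff`). On the coefficients, `d` becomes `D = ∑ ∂_i (dλ_i ∧ ·)`, with
formal derivatives `∂_i` in `d + 1` variables, so exactness is an algebraic statement.

The `dλ_i` are dependent: they sum to zero. Wedging with `σ = ∑ dx_i` embeds the forms on `ℝ^d` into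
the forms on `ℝ^(d+1)` killed by `σ ∧ ·`, and up to sign `dλ_i` becomes `dx_i`. There `dx_i ∧ ·` and
contraction with `e_i` are creation and annihilation operators. Without the constraint `σ ∧ a = 0`,
the complex is exact by the Koszul homotopy `Dκ + κD = r + q`, with `r` the polynomial degree and
`q` the form degree (`extD_koszul_add`); `κ` respects the vanishing conditions because it raises the
exponent `α_i` exactly when it contracts with `e_i`. In positive polynomial degree `σ ∧ ·` is exact
too, by contraction with some `e_j` for which `α_j ≠ 0`.

As `D` and `σ ∧ ·` anticommute, an induction on `r` passes to the kernels of `σ ∧ ·`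
(`exists_extD_eq_of_sum_w_eq_zero`). The only obstruction sits at `r = 0` in top form degree, and
the functional `X^α a ↦ α! a` transports it unchanged through the induction.

In top degree this functional must be compared with the integral. Stokes' theorem for bubble forms
comes from translation invariance of Lebesgue measure (`integral_sum_bernstein_mul_dbary`).
Subtracting a multiple of `λ_0^r` makes any top form exact; if its integral is zero, positivity of
`∫ λ_0^r` forces that multiple to be zero. -/

noncomputable section

namespace BubbleComplex

/-! ### Algebraic core: Koszul homotopy and reduction to the kernel of `∑ w_i`. -/

section Koszul

variable {ι M M' : Type*} [AddCommGroup M] [Module ℝ M] [AddCommGroup M'] [Module ℝ M']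

/-- Polynomials in the variables `X_i`, `i : ι`, with coefficients in `M`. -/
abbrev Poly (ι M : Type*) [AddCommGroup M] : Type _ := (ι → ℕ) →₀ M

lemma eq_zero_of_eq_neg_self {a : M} (h : a = -a) : a = 0 := by
  have h2 : (2 : ℝ) • a = 0 := by
    rw [two_smul]
    nth_rewrite 1 [h]
    simp
  simpa using h2

namespace Poly

/-- Application of a linear map to the coefficients. -/
def map (f : M →ₗ[ℝ] M') : Poly ι M →ₗ[ℝ] Poly ι M' := Finsupp.mapRange.linearMap f

@[simp] lemma map_single (f : M →ₗ[ℝ] M') (α : ι → ℕ) (a : M) :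
    map f (Finsupp.single α a) = Finsupp.single α (f a) := by
  simp [map]

@[simp] lemma map_apply (f : M →ₗ[ℝ] M') (u : Poly ι M) (α : ι → ℕ) : map f u α = f (u α) := by
  simp [map]

lemma linearMap_eq_of_single {f g : Poly ι M →ₗ[ℝ] M'}
    (h : ∀ α a, f (Finsupp.single α a) = g (Finsupp.single α a)) (u : Poly ι M) : f u = g u := by
  have : f = g := Finsupp.lhom_ext h
  rw [this]

variable [DecidableEq ι]

/-- Partial derivative with respect to `X_i`. -/
def pderiv (i : ι) : Poly ι M →ₗ[ℝ] Poly ι M :=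
  Finsupp.lsum ℝ fun α => (α i : ℝ) • Finsupp.lsingle (α - Pi.single i 1)

/-- Multiplication by `X_i`. -/
def mulX (i : ι) : Poly ι M →ₗ[ℝ] Poly ι M :=
  Finsupp.lsum ℝ fun α => Finsupp.lsingle (α + Pi.single i 1)

@[simp] lemma pderiv_single (i : ι) (α : ι → ℕ) (a : M) :
    pderiv i (Finsupp.single α a) = (α i : ℝ) • Finsupp.single (α - Pi.single i 1) a := by
  simp only [pderiv, Finsupp.lsum_single, LinearMap.smul_apply, Finsupp.lsingle_apply]

@[simp] lemma mulX_single (i : ι) (α : ι → ℕ) (a : M) :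
    mulX i (Finsupp.single α a) = Finsupp.single (α + Pi.single i 1) a := by
  simp only [mulX, Finsupp.lsum_single, Finsupp.lsingle_apply]

lemma sub_single_add_single {α : ι → ℕ} {i : ι} (h : α i ≠ 0) :
    α - Pi.single i 1 + Pi.single i 1 = α := by
  funext j
  by_cases hj : j = i
  · subst hj; simp; omega
  · simp [hj]

lemma pderiv_mulX (i j : ι) (u : Poly ι M) :
    pderiv i (mulX j u) = mulX j (pderiv i u) + if i = j then u else 0 := by
  have : ∀ α (a : M), (pderiv i ∘ₗ mulX j) (Finsupp.single α a)
      = (mulX j ∘ₗ pderiv i + if i = j then LinearMap.id else 0 : Poly ι M →ₗ[ℝ] Poly ι M)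
          (Finsupp.single α a) := by
    intro α a
    by_cases hij : i = j
    · subst hij
      by_cases h0 : α i = 0
      · simp [h0]
      · simp only [LinearMap.comp_apply, mulX_single, pderiv_single, LinearMap.add_apply, map_smul,
          sub_single_add_single h0, if_true, LinearMap.id_apply, add_tsub_cancel_right,
          Pi.add_apply, Pi.single_eq_same]
        rw [Nat.cast_add, add_smul]; simp
    · have hji : ¬ j = i := fun h => hij h.symm
      by_cases h0 : α i = 0
      · simp [h0, hij]
      · have : α + Pi.single j 1 - Pi.single i 1 = α - Pi.single i 1 + Pi.single j 1 := by
          funext l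
          by_cases hl : l = i
          · subst hl; simp [hij]
          · simp [hl]
        simp [hij, this]
  have := linearMap_eq_of_single this u
  by_cases hij : i = j <;> simpa [hij] using this

lemma pderiv_comm (i j : ι) (u : Poly ι M) : pderiv i (pderiv j u) = pderiv j (pderiv i u) := by
  refine linearMap_eq_of_single (f := pderiv i ∘ₗ pderiv j) (g := pderiv j ∘ₗ pderiv i)
    (fun α a => ?_) u
  by_cases hij : i = j
  · subst hij; rfl
  · have hji : ¬ j = i := fun h => hij h.symm
    have : α - Pi.single j 1 - Pi.single i 1 = α - Pi.single i 1 - Pi.single j 1 :=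
      tsub_right_comm
    simp [hij, hji, this, smul_smul, mul_comm]

lemma map_pderiv (f : M →ₗ[ℝ] M') (i : ι) (u : Poly ι M) :
    map f (pderiv i u) = pderiv i (map f u) := by
  refine linearMap_eq_of_single (f := map f ∘ₗ pderiv i) (g := pderiv i ∘ₗ map f)
    (fun α a => ?_) u
  simp

lemma map_mulX (f : M →ₗ[ℝ] M') (i : ι) (u : Poly ι M) :
    map f (mulX i u) = mulX i (map f u) := by
  refine linearMap_eq_of_single (f := map f ∘ₗ mulX i) (g := mulX i ∘ₗ map f)
    (fun α a => ?_) u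
  simp

/-- The coefficients of polynomials vanishing at the faces in the sense of the operators `w`,
homogeneous of degree `r`, with coefficients in `G`. -/
def tangential (w : ι → M →ₗ[ℝ] M) (G : Submodule ℝ M) [Fintype ι] (r : ℕ) :
    Submodule ℝ (Poly ι M) where
  carrier := {u | ∀ α, u α ∈ G ∧ (∑ i, α i ≠ r → u α = 0) ∧ ∀ i, α i = 0 → w i (u α) = 0}
  add_mem' hu hv α := by
    refine ⟨G.add_mem (hu α).1 (hv α).1, fun h => ?_, fun i h => ?_⟩
    · simp [(hu α).2.1 h, (hv α).2.1 h]
    · simp [(hu α).2.2 i h, (hv α).2.2 i h]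
  zero_mem' α := by simp
  smul_mem' c u hu α := by
    refine ⟨G.smul_mem c (hu α).1, fun h => ?_, fun i h => ?_⟩
    · simp [(hu α).2.1 h]
    · simp [(hu α).2.2 i h]

variable [Fintype ι] {w : ι → M →ₗ[ℝ] M} {w' : ι → M' →ₗ[ℝ] M'} {c : ι → M →ₗ[ℝ] M}
  {G G₁ : Submodule ℝ M} {G' : Submodule ℝ M'} {r : ℕ}

lemma single_mem_tangential {α : ι → ℕ} {a : M} (hG : a ∈ G) (hr : ∑ i, α i = r)
    (hw : ∀ i, α i = 0 → w i a = 0) : Finsupp.single α a ∈ tangential w G r := by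
  intro β
  by_cases h : α = β
  · subst h
    simpa [hG, hr] using hw
  · simp [Finsupp.single_eq_of_ne' h]

/-- The conditions constrain each coefficient separately, so linear statements can be checked on
single monomials. -/
lemma map_mem_of_tangential {N : Type*} [AddCommGroup N] [Module ℝ N] (L : Poly ι M →ₗ[ℝ] N)
    (S : Submodule ℝ N) {u : Poly ι M} (hu : u ∈ tangential w G r)
    (h : ∀ α a, a ∈ G → ∑ i, α i = r → (∀ i, α i = 0 → w i a = 0) →
      L (Finsupp.single α a) ∈ S) : L u ∈ S := by
  rw [← Finsupp.sum_single u, Finsupp.sum, map_sum]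
  refine S.sum_mem fun α hα => ?_
  refine h α _ (hu α).1 ?_ (hu α).2.2
  by_contra h'
  exact (Finsupp.mem_support_iff.1 hα) ((hu α).2.1 h')

lemma map_eq_of_tangential {N : Type*} [AddCommGroup N] [Module ℝ N] (L L' : Poly ι M →ₗ[ℝ] N)
    {u : Poly ι M} (hu : u ∈ tangential w G r)
    (h : ∀ α a, a ∈ G → ∑ i, α i = r → (∀ i, α i = 0 → w i a = 0) →
      L (Finsupp.single α a) = L' (Finsupp.single α a)) : L u = L' u := by
  have := map_mem_of_tangential (L - L') ⊥ hu (fun α a h1 h2 h3 => by simp [h α a h1 h2 h3])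
  simpa [sub_eq_zero] using this

lemma map_mem_tangential {f : M →ₗ[ℝ] M'} {u : Poly ι M} (hu : u ∈ tangential w G r)
    (hG : ∀ α, f (u α) ∈ G') (hw : ∀ α i, w i (u α) = 0 → w' i (f (u α)) = 0) :
    map f u ∈ tangential w' G' r := by
  intro α
  simp only [map_apply]
  exact ⟨hG α, fun h => by rw [(hu α).2.1 h, map_zero], fun i h => hw α i ((hu α).2.2 i h)⟩

/-- The exterior derivative `∑ ∂_i w_i`. -/
def extD (w : ι → M →ₗ[ℝ] M) : Poly ι M →ₗ[ℝ] Poly ι M := ∑ i, pderiv i ∘ₗ map (w i)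

/-- The contraction with the Euler vector field `∑ X_i c_i`. -/
def koszul (c : ι → M →ₗ[ℝ] M) : Poly ι M →ₗ[ℝ] Poly ι M := ∑ i, mulX i ∘ₗ map (c i)

lemma extD_apply (u : Poly ι M) : extD w u = ∑ i, pderiv i (map (w i) u) := by
  simp [extD]

lemma koszul_apply (u : Poly ι M) : koszul c u = ∑ i, mulX i (map (c i) u) := by
  simp [koszul]

lemma extD_single (α : ι → ℕ) (a : M) : extD w (Finsupp.single α a)
    = ∑ i, (α i : ℝ) • Finsupp.single (α - Pi.single i 1) (w i a) := by
  simp [extD_apply]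

lemma sum_sub_single {α : ι → ℕ} {i : ι} (h : α i ≠ 0) :
    ∑ j, (α - Pi.single i 1 : ι → ℕ) j + 1 = ∑ j, α j := by
  conv_rhs => rw [← sub_single_add_single h]
  simp [Finset.sum_add_distrib]

/-- Lowering `α_i` may create a new condition only at `i`, and it holds because `w_i w_i = 0`; the
conditions at other indices survive by anticommutation. -/
lemma extD_mem_tangential (ww : ∀ i j a, w i (w j a) = - w j (w i a))
    (hG : ∀ i, ∀ a ∈ G, w i a ∈ G₁) {u : Poly ι M} (hu : u ∈ tangential w G (r + 1)) :
    extD w u ∈ tangential w G₁ r := by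
  refine map_mem_of_tangential _ _ hu fun α a ha hr hw => ?_
  rw [extD_single]
  refine Submodule.sum_mem _ fun i _ => ?_
  by_cases h0 : α i = 0
  · simp [h0]
  refine Submodule.smul_mem _ _ (single_mem_tangential (hG i a ha) ?_ fun j hj => ?_)
  · have := sum_sub_single h0
    omega
  · by_cases hji : j = i
    · subst hji
      have := ww j j a
      exact eq_zero_of_eq_neg_self this
    · rw [ww, hw j (by simpa [hji] using hj)]
      simp

lemma extD_extD (ww : ∀ i j a, w i (w j a) = - w j (w i a)) (u : Poly ι M) :
    extD w (extD w u) = 0 := by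
  have h : extD w (extD w u) = - extD w (extD w u) := by
    simp only [extD_apply, map_sum, map_pderiv]
    conv_lhs => rw [Finset.sum_comm]
    rw [← Finset.sum_neg_distrib]
    refine Finset.sum_congr rfl fun i _ => ?_
    rw [← Finset.sum_neg_distrib]
    refine Finset.sum_congr rfl fun j _ => ?_
    rw [pderiv_comm, ← map_neg, ← map_neg]
    congr 2
    ext α
    simp [ww j i]
  exact eq_zero_of_eq_neg_self h

lemma map_extD {f : M →ₗ[ℝ] M'} (hf : ∀ i a, f (w i a) = - w' i (f a)) (u : Poly ι M) :
    map f (extD w u) = - extD w' (map f u) := by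
  simp only [extD_apply, map_sum, map_pderiv]
  rw [← Finset.sum_neg_distrib]
  refine Finset.sum_congr rfl fun i _ => ?_
  rw [← map_neg]
  congr 1
  ext α
  simp [hf]

/-- The functional `X^α ⊗ a ↦ α! a`. -/
def factSum : Poly ι M →ₗ[ℝ] M :=
  Finsupp.lsum ℝ fun α => ((∏ i, (α i).factorial : ℕ) : ℝ) • LinearMap.id

lemma factSum_single (α : ι → ℕ) (a : M) :
    factSum (Finsupp.single α a) = ((∏ i, (α i).factorial : ℕ) : ℝ) • a := by
  simp only [factSum, Finsupp.lsum_single, LinearMap.smul_apply, LinearMap.id_apply]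

lemma prod_factorial_sub_single {α : ι → ℕ} {i : ι} (h : α i ≠ 0) :
    α i * ∏ j, ((α - Pi.single i 1 : ι → ℕ) j).factorial = ∏ j, (α j).factorial := by
  rw [← Finset.mul_prod_erase Finset.univ _ (Finset.mem_univ i),
    ← Finset.mul_prod_erase Finset.univ _ (Finset.mem_univ i), ← mul_assoc]
  congr 1
  · simp [Nat.mul_factorial_pred h]
  · refine Finset.prod_congr rfl fun j hj => ?_
    simp [Finset.ne_of_mem_erase hj]

/-- `α_i (α - e_i)! = α!`, while the terms with `α_i = 0` drop out by tangentiality. This is what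
carries the top-degree obstruction through the induction. -/
lemma factSum_extD {u : Poly ι M} (hu : u ∈ tangential w G r) :
    factSum (extD w u) = factSum (map (∑ i, w i) u) := by
  refine map_eq_of_tangential (factSum ∘ₗ extD w) (factSum ∘ₗ map (∑ i, w i)) hu
    fun α a _ _ hw => ?_
  simp only [LinearMap.comp_apply, extD_single, map_sum, map_smul, factSum_single, map_single,
    LinearMap.sum_apply, Finset.smul_sum]
  refine Finset.sum_congr rfl fun i _ => ?_
  by_cases h0 : α i = 0
  · simp [h0, hw i h0]
  · rw [smul_smul, ← prod_factorial_sub_single h0]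
    push_cast
    rfl

end Poly

open BubbleComplex.Poly

/-- Creation and annihilation operators. -/
structure IsFermionic [DecidableEq ι] (w c : ι → M →ₗ[ℝ] M) : Prop where
  ww : ∀ i j a, w i (w j a) = - w j (w i a)
  cc : ∀ i j a, c i (c j a) = - c j (c i a)
  cw : ∀ i j a, c i (w j a) = (if i = j then a else 0) - w j (c i a)

/-- The eigenspace of the number operator `∑ w_i c_i` for the eigenvalue `q`. -/
def numberSpace [Fintype ι] (w c : ι → M →ₗ[ℝ] M) (q : ℝ) : Submodule ℝ M :=
  LinearMap.ker ((∑ i, w i ∘ₗ c i) - q • LinearMap.id)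

lemma mem_numberSpace [Fintype ι] {w c : ι → M →ₗ[ℝ] M} {q : ℝ} {a : M} :
    a ∈ numberSpace w c q ↔ ∑ i, w i (c i a) = q • a := by
  simp [numberSpace, sub_eq_zero]

namespace IsFermionic

variable [DecidableEq ι] [Fintype ι] {w c : ι → M →ₗ[ℝ] M} (h : IsFermionic w c)
include h

lemma c_mem {q : ℝ} {a : M} (ha : a ∈ numberSpace w c q) (j : ι) :
    c j a ∈ numberSpace w c (q - 1) := by
  rw [mem_numberSpace] at *
  have h1 : ∀ i, w i (c i (c j a)) = c j (w i (c i a)) - (if j = i then c i a else 0) := by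
    intro i
    rw [h.cw j i, h.cc i j]
    simp
  simp_rw [h1]
  rw [Finset.sum_sub_distrib, ← map_sum, ha]
  simp [sub_smul]

lemma w_mem {q : ℝ} {a : M} (ha : a ∈ numberSpace w c q) (j : ι) :
    w j a ∈ numberSpace w c (q + 1) := by
  rw [mem_numberSpace] at *
  have h1 : ∀ i, w i (c i (w j a)) = w j (w i (c i a)) + (if i = j then w i a else 0) := by
    intro i
    rw [h.cw i j, map_sub, h.ww i j (c i a)]
    by_cases hij : i = j <;> simp [hij, add_comm]
  simp_rw [h1]
  rw [Finset.sum_add_distrib, ← map_sum, ha]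
  simp [add_smul]

lemma sum_w_mem {q : ℝ} {a : M} (ha : a ∈ numberSpace w c q) :
    (∑ j, w j) a ∈ numberSpace w c (q + 1) := by
  rw [LinearMap.sum_apply]
  exact Submodule.sum_mem _ fun j _ => h.w_mem ha j

/-- Every `c_j` is a contracting homotopy for `∑ w_i`. -/
lemma c_sum_w (j : ι) (a : M) : c j ((∑ i, w i) a) = a - (∑ i, w i) (c j a) := by
  simp [h.cw, Finset.sum_sub_distrib]

lemma w_sum_w (j : ι) (a : M) : w j ((∑ i, w i) a) = - (∑ i, w i) (w j a) := by
  simp [h.ww j]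

lemma sum_w_sum_w (a : M) : (∑ i, w i) ((∑ i, w i) a) = 0 := by
  refine eq_zero_of_eq_neg_self ?_
  conv_lhs => rw [LinearMap.sum_apply]
  simp only [h.w_sum_w]
  rw [Finset.sum_neg_distrib, ← map_sum, ← LinearMap.sum_apply]

/-- Multiplication by `X_i` voids the condition at `i`, and `c_i` anticommutes with `w_j` for `j ≠
i`, so the remaining conditions persist. -/
lemma koszul_mem_tangential {q : ℝ} {r : ℕ} {u : Poly ι M}
    (hu : u ∈ tangential w (numberSpace w c q) r) :
    koszul c u ∈ tangential w (numberSpace w c (q - 1)) (r + 1) := by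
  refine map_mem_of_tangential _ _ hu fun α a ha hr hw => ?_
  simp only [koszul_apply, map_single, mulX_single]
  refine Submodule.sum_mem _ fun i _ => single_mem_tangential (h.c_mem ha i) ?_ fun j hj => ?_
  · simp [Finset.sum_add_distrib, hr]
  · have hij : ¬ i = j := by
      rintro rfl
      simp at hj
    have hj' : α j = 0 := by
      simp at hj
      exact hj.1
    have := h.cw i j a
    rw [hw j hj', if_neg hij, map_zero, zero_sub, eq_comm, neg_eq_zero] at this
    exact this

/-- Euler's identity for homogeneous polynomials. -/
lemma sum_mulX_pderiv {q : ℝ} {r : ℕ} {u : Poly ι M}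
    (hu : u ∈ tangential w (numberSpace w c q) r) :
    ∑ i, mulX i (pderiv i u) = (r : ℝ) • u := by
  have := map_eq_of_tangential (∑ i, mulX i ∘ₗ pderiv i) ((r : ℝ) • LinearMap.id) hu
    (fun α a _ hr _ => ?_)
  · simpa using this
  · simp only [LinearMap.sum_apply, LinearMap.comp_apply, pderiv_single, map_smul, mulX_single,
      LinearMap.smul_apply, LinearMap.id_apply, ← hr, Nat.cast_sum, Finset.sum_smul]
    refine Finset.sum_congr rfl fun i _ => ?_
    by_cases h0 : α i = 0
    · simp [h0]
    · rw [sub_single_add_single h0]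

/-- The homotopy formula. -/
lemma extD_koszul_add {q : ℝ} {r : ℕ} {u : Poly ι M}
    (hu : u ∈ tangential w (numberSpace w c q) r) :
    extD w (koszul c u) + koszul c (extD w u) = ((r : ℝ) + q) • u := by
  -- Off-diagonal terms cancel by anticommutation. The diagonal ones add up to the number operator,
  -- with eigenvalue `q`, plus the Euler operator, with eigenvalue `r`.
  have h1 : ∀ i j, pderiv i (map (w i) (mulX j (map (c j) u))) +
      mulX j (map (c j) (pderiv i (map (w i) u))) =
      if i = j then map (w i) (map (c i) u) + mulX i (pderiv i u) else 0 := by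
    intro i j
    have e : map (c j) (map (w i) u) = (if i = j then u else 0) - map (w i) (map (c j) u) := by
      ext α
      by_cases hij : i = j
      · simp [hij, h.cw]
      · have hji : ¬ j = i := fun h => hij h.symm
        simp [hij, hji, h.cw]
    rw [map_mulX, map_pderiv, pderiv_mulX, e]
    by_cases hij : i = j
    · subst hij
      simp only [if_true, map_sub]
      abel
    · simp [hij]
  simp only [extD_apply, koszul_apply, map_sum]
  conv_lhs =>
    enter [2]
    rw [Finset.sum_comm]
  rw [← Finset.sum_add_distrib]
  simp only [← Finset.sum_add_distrib]
  refine (Finset.sum_congr rfl fun j _ => Finset.sum_congr rfl fun i _ => h1 i j).trans ?_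
  rw [Finset.sum_congr rfl fun j _ => (Finset.sum_ite_eq' Finset.univ j fun i =>
    map (w i) (map (c i) u) + mulX i (pderiv i u))]
  simp only [Finset.mem_univ, if_true]
  rw [Finset.sum_add_distrib, h.sum_mulX_pderiv hu, add_smul, add_comm]
  congr 1
  ext α
  rw [Finsupp.finsetSum_apply]
  simpa using mem_numberSpace.1 (hu α).1

/-- The homogeneous complex is exact. -/
lemma exists_extD_eq {q : ℝ} {r : ℕ} (hrq : (r : ℝ) + q ≠ 0) {u : Poly ι M}
    (hu : u ∈ tangential w (numberSpace w c q) r) (hD : extD w u = 0) :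
    ∃ v ∈ tangential w (numberSpace w c (q - 1)) (r + 1), extD w v = u := by
  refine ⟨((r : ℝ) + q)⁻¹ • koszul c u, Submodule.smul_mem _ _ (h.koszul_mem_tangential hu), ?_⟩
  have := h.extD_koszul_add hu
  rw [hD, map_zero, add_zero] at this
  rw [map_smul, this, smul_smul, inv_mul_cancel₀ hrq, one_smul]

/-- In positive degree each `α` has some `α_j ≠ 0`. Applying that `c_j` to the coefficient inverts
`∑ w_i` on its kernel, and only the condition at `j`, which is void, could be disturbed. -/
lemma exists_sum_w_eq {q : ℝ} {r : ℕ} {u : Poly ι M}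
    (hu : u ∈ tangential w (numberSpace w c q) (r + 1)) (hJ : map (∑ i, w i) u = 0) :
    ∃ y ∈ tangential w (numberSpace w c (q - 1)) (r + 1), map (∑ i, w i) y = u := by
  have hj : ∀ α : ι → ℕ, ∑ i, α i = r + 1 → ∃ j, α j ≠ 0 := by
    intro α hα
    by_contra! h0
    simp [h0] at hα
  let g : (ι → ℕ) → M → M := fun α a =>
    if hα : ∑ i, α i = r + 1 then c (hj α hα).choose a else 0
  have g0 : ∀ α, g α 0 = 0 := by
    intro α
    by_cases hα : ∑ i, α i = r + 1 <;> simp [g, hα]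
  let y : Poly ι M := Finsupp.onFinset u.support (fun α => g α (u α)) (by
    intro α hα
    rw [Finsupp.mem_support_iff]
    intro h0
    exact hα (by rw [h0, g0]))
  have hy : ∀ α, y α = g α (u α) := fun α => rfl
  refine ⟨y, fun α => ?_, ?_⟩
  · rw [hy]
    by_cases hα : ∑ i, α i = r + 1
    · simp only [g, hα, dite_true]
      refine ⟨h.c_mem (hu α).1 _, by simp, fun i hi => ?_⟩
      have hne : ¬ (hj α hα).choose = i := by
        intro h'
        exact (hj α hα).choose_spec (h' ▸ hi)
      have := h.cw (hj α hα).choose i (u α)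
      rw [(hu α).2.2 i hi, if_neg hne, map_zero, zero_sub, eq_comm, neg_eq_zero] at this
      exact this
    · simp [g, hα]
  · ext α
    rw [map_apply, hy]
    by_cases hα : ∑ i, α i = r + 1
    · simp only [g, hα, dite_true]
      have h1 := h.c_sum_w (hj α hα).choose (u α)
      have h2 := DFunLike.congr_fun hJ α
      rw [map_apply, Finsupp.zero_apply] at h2
      rw [h2, map_zero, eq_comm, sub_eq_zero] at h1
      exact h1.symm
    · simp [g, hα, (hu α).2.1 hα]

/-- The complex of the kernels of `∑ w_i` is exact, except at the end, where the cokernel is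
detected by `factSum`. -/
theorem exists_extD_eq_of_sum_w_eq_zero {q : ℝ} (hq : 1 ≤ q) {r : ℕ} {u : Poly ι M}
    (hu : u ∈ tangential w (numberSpace w c q) r) (hJ : map (∑ i, w i) u = 0)
    (hD : extD w u = 0) (htop : q ≠ Fintype.card ι ∨ factSum u = 0) :
    ∃ z ∈ tangential w (numberSpace w c (q - 1)) (r + 1),
      map (∑ i, w i) z = 0 ∧ extD w z = u := by
  have hσD : ∀ v, map (∑ i, w i) (extD w v) = - extD w (map (∑ i, w i) v) := fun v =>
    map_extD (w' := w) (fun i a => by rw [h.w_sum_w, neg_neg]) v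
  induction r generalizing u with
  | zero =>
    have hu0 : u = Finsupp.single 0 (u 0) := by
      ext α
      by_cases hα : α = 0
      · simp [hα]
      · rw [Finsupp.single_eq_of_ne hα]
        refine (hu α).2.1 fun h' => hα ?_
        funext i
        simpa using (Finset.sum_eq_zero_iff.1 h') i (Finset.mem_univ i)
    suffices u 0 = 0 by
      refine ⟨0, Submodule.zero_mem _, by simp, ?_⟩
      rw [hu0, this]
      simp
    rcases htop with htop | htop
    -- At `α = 0` all `w_i` kill the coefficient, so `w_i c_i` fixes it for each `i` and its number
    -- eigenvalue is both `q` and `Fintype.card ι`.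
    · have hw : ∀ i, w i (u 0) = 0 := fun i => (hu 0).2.2 i rfl
      have hN := mem_numberSpace.1 (hu 0).1
      have h1 : ∀ i, w i (c i (u 0)) = u 0 := by
        intro i
        have := h.cw i i (u 0)
        rw [hw i, if_pos rfl, map_zero, eq_comm, sub_eq_zero] at this
        exact this.symm
      simp only [h1, Finset.sum_const, Finset.card_univ] at hN
      rw [← Nat.cast_smul_eq_nsmul ℝ, ← sub_eq_zero, ← sub_smul] at hN
      rcases smul_eq_zero.1 hN with h2 | h2
      · exact absurd (sub_eq_zero.1 h2).symm htop
      · exact h2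
    · rw [hu0, factSum_single] at htop
      simpa using htop
  | succ r ih =>
    -- Zigzag with `σ = ∑ w_i` and `D = extD w`: lift `u = σ y`, correct `y` by some `z` with `σ z =
    -- 0` and `D z = D y`, write `y - z = D v`, and take `-σ v` as the primitive of `u`.
    obtain ⟨y, hy, hyu⟩ := h.exists_sum_w_eq hu hJ
    have hDy : extD w y ∈ tangential w (numberSpace w c q) r := by
      refine extD_mem_tangential h.ww (fun i a ha => ?_) hy
      simpa using h.w_mem ha i
    -- `D y` has the form degree of `u` and one polynomial degree less, and `factSum (D y) = factSum
    -- (σ y) = factSum u` preserves the top-degree hypothesis.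
    obtain ⟨z, hz, hz1, hz2⟩ := ih hDy (by rw [hσD, hyu, hD, neg_zero]) (extD_extD h.ww y)
      (htop.imp_right fun h0 => by rw [factSum_extD hy, hyu, h0])
    obtain ⟨v, hv, hvy⟩ := h.exists_extD_eq (q := q - 1) (r := r + 1) (u := y - z)
      -- The homotopy factor is `(r + 1) + (q - 1) = r + q`, nonzero because `q ≥ 1`.
      (by push_cast; have : (0 : ℝ) ≤ r := Nat.cast_nonneg r; linarith)
      (Submodule.sub_mem _ hy hz) (by rw [map_sub, hz2, sub_self])
    refine ⟨- map (∑ i, w i) v, Submodule.neg_mem _ ?_, ?_, ?_⟩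
    · refine map_mem_tangential hv (fun α => ?_) (fun α i h0 => ?_)
      · simpa using h.sum_w_mem (hv α).1
      · rw [h.w_sum_w, h0, map_zero, neg_zero]
    · rw [map_neg, neg_eq_zero]
      ext α
      simpa using h.sum_w_sum_w (v α)
    · rw [map_neg, ← hσD, hvy, map_sub, hyu, hz1, sub_zero]

end IsFermionic
end Koszul

/-! ### Exterior multiplication, contraction and pullback on graded alternating forms. -/

section GradedForms

open ContinuousAlternatingMap

variable {V W : Type*} [NormedAddCommGroup V] [NormedSpace ℝ V]
  [NormedAddCommGroup W] [NormedSpace ℝ W]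

/-- Sequences of alternating forms, one in each degree. -/
abbrev GForm (V : Type*) [NormedAddCommGroup V] [NormedSpace ℝ V] : Type _ :=
  ∀ k : ℕ, V [⋀^Fin k]→L[ℝ] ℝ

/-- Exterior multiplication `ξ ∧ a` of a `k`-form by a `1`-form. -/
def wedgeAlt {k : ℕ} (ξ : V →L[ℝ] ℝ) (a : V [⋀^Fin k]→L[ℝ] ℝ) : V [⋀^Fin (k + 1)]→L[ℝ] ℝ :=
  alternatizeUncurryFin (ξ.smulRight a)

lemma wedgeAlt_apply {k : ℕ} (ξ : V →L[ℝ] ℝ) (a : V [⋀^Fin k]→L[ℝ] ℝ) (v : Fin (k + 1) → V) :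
    wedgeAlt ξ a v = ∑ i : Fin (k + 1), (-1) ^ (i : ℕ) • (ξ (v i) * a (Fin.removeNth i v)) := by
  simp [wedgeAlt, alternatizeUncurryFin_apply]

lemma wedgeAlt_add {k : ℕ} (ξ : V →L[ℝ] ℝ) (a b : V [⋀^Fin k]→L[ℝ] ℝ) :
    wedgeAlt ξ (a + b) = wedgeAlt ξ a + wedgeAlt ξ b := by
  ext v
  simp [wedgeAlt_apply, mul_add, Finset.sum_add_distrib]

lemma wedgeAlt_smul {k : ℕ} (c : ℝ) (ξ : V →L[ℝ] ℝ) (a : V [⋀^Fin k]→L[ℝ] ℝ) :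
    wedgeAlt ξ (c • a) = c • wedgeAlt ξ a := by
  ext v
  simp [wedgeAlt_apply, Finset.mul_sum, mul_left_comm]

lemma wedgeAlt_sub_left {k : ℕ} (ξ ζ : V →L[ℝ] ℝ) (a : V [⋀^Fin k]→L[ℝ] ℝ) :
    wedgeAlt (ξ - ζ) a = wedgeAlt ξ a - wedgeAlt ζ a := by
  ext v
  simp [wedgeAlt_apply, sub_mul, smul_sub, Finset.sum_sub_distrib]

lemma wedgeAlt_smul_left {k : ℕ} (c : ℝ) (ξ : V →L[ℝ] ℝ) (a : V [⋀^Fin k]→L[ℝ] ℝ) :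
    wedgeAlt (c • ξ) a = c • wedgeAlt ξ a := by
  ext v
  simp [wedgeAlt_apply, Finset.mul_sum, mul_left_comm, mul_assoc]

lemma wedgeAlt_sum_left {κ : Type*} (s : Finset κ) {k : ℕ} (ξ : κ → V →L[ℝ] ℝ)
    (a : V [⋀^Fin k]→L[ℝ] ℝ) : wedgeAlt (∑ i ∈ s, ξ i) a = ∑ i ∈ s, wedgeAlt (ξ i) a := by
  ext v
  simp only [wedgeAlt_apply, _root_.sum_apply, Finset.sum_mul, Finset.smul_sum,
    ContinuousAlternatingMap.sum_apply]
  rw [Finset.sum_comm]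

lemma wedgeAlt_add_left {k : ℕ} (ξ ζ : V →L[ℝ] ℝ) (a : V [⋀^Fin k]→L[ℝ] ℝ) :
    wedgeAlt (ξ + ζ) a = wedgeAlt ξ a + wedgeAlt ζ a := by
  ext v
  simp [wedgeAlt_apply, add_mul, smul_add, Finset.sum_add_distrib]

/-- `(x, y) ↦ ξ x • ξ y • a` is symmetric, so alternating it twice gives zero. -/
lemma wedgeAlt_self {k : ℕ} (ξ : V →L[ℝ] ℝ) (a : V [⋀^Fin k]→L[ℝ] ℝ) :
    wedgeAlt ξ (wedgeAlt ξ a) = 0 := by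
  have h := alternatizeUncurryFin_alternatizeUncurryFinCLM_comp_of_symmetric
    (f := ξ.smulRight (ξ.smulRight a)) (fun x y => by ext v; simp; ring)
  rw [← h, wedgeAlt]
  congr 1
  ext x v
  simp [wedgeAlt]

lemma wedgeAlt_anticomm {k : ℕ} (ξ ζ : V →L[ℝ] ℝ) (a : V [⋀^Fin k]→L[ℝ] ℝ) :
    wedgeAlt ξ (wedgeAlt ζ a) = - wedgeAlt ζ (wedgeAlt ξ a) := by
  have h := wedgeAlt_self (ξ + ζ) a
  simp only [wedgeAlt_add_left, wedgeAlt_add, wedgeAlt_self, zero_add, add_zero] at h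
  exact eq_neg_of_add_eq_zero_right h

lemma curryLeft_wedgeAlt_zero (ξ : V →L[ℝ] ℝ) (a : V [⋀^Fin 0]→L[ℝ] ℝ) (x : V) :
    curryLeft (wedgeAlt ξ a) x = ξ x • a := by
  ext v
  simp [wedgeAlt_apply]

lemma curryLeft_wedgeAlt_succ {k : ℕ} (ξ : V →L[ℝ] ℝ) (a : V [⋀^Fin (k + 1)]→L[ℝ] ℝ) (x : V) :
    curryLeft (wedgeAlt ξ a) x = ξ x • a - wedgeAlt ξ (curryLeft a x) := by
  ext v
  rw [curryLeft_apply_apply, wedgeAlt_apply, Fin.sum_univ_succ]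
  rw [ContinuousAlternatingMap.sub_apply, ContinuousAlternatingMap.smul_apply,
    wedgeAlt_apply, sub_eq_add_neg, ← Finset.sum_neg_distrib]
  congr 1
  · simp [Matrix.vecCons]
  · refine Finset.sum_congr rfl fun i _ => ?_
    have : Fin.removeNth i.succ (Matrix.vecCons x v) = Matrix.vecCons x (Fin.removeNth i v) := by
      funext j
      refine Fin.cases ?_ (fun j => ?_) j
      · simp [Fin.removeNth]
      · simp [Fin.removeNth]
    rw [this]
    simp [pow_succ]

lemma wedgeAlt_compContinuousLinearMap {k : ℕ} (ξ : W →L[ℝ] ℝ) (a : W [⋀^Fin k]→L[ℝ] ℝ)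
    (L : V →L[ℝ] W) : (wedgeAlt ξ a).compContinuousLinearMap L =
      wedgeAlt (ξ.comp L) (a.compContinuousLinearMap L) := by
  ext v
  simp only [compContinuousLinearMap_apply, wedgeAlt_apply]
  rfl

/-- Exterior multiplication by a `1`-form. -/
def wedge (ξ : V →L[ℝ] ℝ) : GForm V →ₗ[ℝ] GForm V where
  toFun a k := match k with
    | 0 => 0
    | k + 1 => wedgeAlt ξ (a k)
  map_add' a b := by
    funext k
    cases k with
    | zero => simp
    | succ k => exact wedgeAlt_add _ _ _
  map_smul' c a := by
    funext k
    cases k with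
    | zero => simp
    | succ k => exact wedgeAlt_smul _ _ _

/-- Contraction with a vector. -/
def contract (x : V) : GForm V →ₗ[ℝ] GForm V where
  toFun a k := curryLeft (a (k + 1)) x
  map_add' a b := by funext k; simp
  map_smul' c a := by funext k; simp

/-- Pullback by a linear map. -/
def pullback (L : V →L[ℝ] W) : GForm W →ₗ[ℝ] GForm V where
  toFun a k := (a k).compContinuousLinearMap L
  map_add' a b := by funext k; ext v; simp
  map_smul' c a := by funext k; ext v; simp

@[simp] lemma wedge_zero_apply (ξ : V →L[ℝ] ℝ) (a : GForm V) : wedge ξ a 0 = 0 := rfl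

@[simp] lemma wedge_succ_apply (ξ : V →L[ℝ] ℝ) (a : GForm V) (k : ℕ) :
    wedge ξ a (k + 1) = wedgeAlt ξ (a k) := rfl

@[simp] lemma contract_apply (x : V) (a : GForm V) (k : ℕ) :
    contract x a k = curryLeft (a (k + 1)) x := rfl

@[simp] lemma pullback_apply (L : V →L[ℝ] W) (a : GForm W) (k : ℕ) :
    pullback L a k = (a k).compContinuousLinearMap L := rfl

lemma wedge_anticomm (ξ ζ : V →L[ℝ] ℝ) (a : GForm V) :
    wedge ξ (wedge ζ a) = - wedge ζ (wedge ξ a) := by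
  funext k
  match k with
  | 0 => simp
  | 1 => ext v; simp [wedgeAlt_apply]
  | k + 2 => exact wedgeAlt_anticomm _ _ _

lemma contract_anticomm (x y : V) (a : GForm V) :
    contract x (contract y a) = - contract y (contract x a) := by
  have h : ∀ (z : V) k, curryLeft (curryLeft (a (k + 1 + 1)) z) z = 0 := fun z k =>
    curryLeft_same _ _
  funext k
  have := h (x + y) k
  simp only [map_add, curryLeft_add, _root_.add_apply, h, zero_add, add_zero] at this
  simpa [eq_neg_iff_add_eq_zero, add_comm] using this

lemma contract_wedge (ξ : V →L[ℝ] ℝ) (x : V) (a : GForm V) :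
    contract x (wedge ξ a) = ξ x • a - wedge ξ (contract x a) := by
  funext k
  match k with
  | 0 => simpa using curryLeft_wedgeAlt_zero ξ (a 0) x
  | k + 1 => exact curryLeft_wedgeAlt_succ _ _ _

lemma pullback_wedge (L : V →L[ℝ] W) (ξ : W →L[ℝ] ℝ) (a : GForm W) :
    pullback L (wedge ξ a) = wedge (ξ.comp L) (pullback L a) := by
  funext k
  match k with
  | 0 => ext; simp
  | k + 1 => exact wedgeAlt_compContinuousLinearMap _ _ _

lemma wedge_sub_left (ξ ζ : V →L[ℝ] ℝ) (a : GForm V) :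
    wedge (ξ - ζ) a = wedge ξ a - wedge ζ a := by
  funext k
  match k with
  | 0 => simp
  | k + 1 => exact wedgeAlt_sub_left _ _ _

lemma wedge_smul_left (c : ℝ) (ξ : V →L[ℝ] ℝ) (a : GForm V) :
    wedge (c • ξ) a = c • wedge ξ a := by
  funext k
  match k with
  | 0 => simp
  | k + 1 => exact wedgeAlt_smul_left _ _ _

lemma wedge_sum_left {κ : Type*} (s : Finset κ) (ξ : κ → V →L[ℝ] ℝ) (a : GForm V) :
    wedge (∑ i ∈ s, ξ i) a = ∑ i ∈ s, wedge (ξ i) a := by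
  funext k
  match k with
  | 0 => simp
  | k + 1 => simpa using wedgeAlt_sum_left _ _ _

lemma wedge_zero_left (a : GForm V) : wedge 0 a = 0 := by
  simpa using wedge_sum_left (∅ : Finset ℕ) (fun _ => (0 : V →L[ℝ] ℝ)) a

/-- `∑ ξ_i ⊗ ι_{e_i} a` is `a` with its first argument curried, and alternating this multiplies `a`
by its degree. Duality is required only as `∑ ξ_i(x) e_i = x`, so the `e_i` need not be independent.
-/
lemma sum_wedge_contract {ι : Type*} [Fintype ι] (e : ι → V) (ξ : ι → V →L[ℝ] ℝ)
    (h : ∀ x, ∑ i, ξ i x • e i = x) (a : GForm V) (k : ℕ) :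
    (∑ i, wedge (ξ i) (contract (e i) a)) k = (k : ℝ) • a k := by
  match k with
  | 0 => simp
  | k + 1 =>
    have h1 : ∑ i, (ξ i).smulRight (curryLeft (a (k + 1)) (e i)) = curryLeft (a (k + 1)) := by
      refine ContinuousLinearMap.ext fun x => ?_
      conv_rhs => rw [← h x]
      simp
    have h2 := alternatizeUncurryFin_curryLeft (a (k + 1))
    rw [← h1] at h2
    simp only [Finset.sum_apply, wedge_succ_apply, wedgeAlt, contract_apply]
    rw [← alternatizeUncurryFinCLM_apply, _root_.map_sum] at h2
    simp only [alternatizeUncurryFinCLM_apply] at h2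
    rw [h2, ← Nat.cast_smul_eq_nsmul ℝ]

/-- The graded forms concentrated in degree `k`. -/
def inDegree (V : Type*) [NormedAddCommGroup V] [NormedSpace ℝ V] (k : ℕ) :
    Submodule ℝ (GForm V) where
  carrier := {a | ∀ l, l ≠ k → a l = 0}
  add_mem' ha hb l hl := by simp [ha l hl, hb l hl]
  zero_mem' l _ := rfl
  smul_mem' c a ha l hl := by simp [ha l hl]

lemma mem_inDegree {k : ℕ} {a : GForm V} : a ∈ inDegree V k ↔ ∀ l, l ≠ k → a l = 0 := Iff.rfl

lemma wedge_mem_inDegree {k : ℕ} {a : GForm V} (ha : a ∈ inDegree V k) (ξ : V →L[ℝ] ℝ) :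
    wedge ξ a ∈ inDegree V (k + 1) := by
  intro l hl
  match l with
  | 0 => rfl
  | l + 1 =>
    rw [wedge_succ_apply, ha l (by omega)]
    simpa using wedgeAlt_smul 0 ξ (0 : V [⋀^Fin l]→L[ℝ] ℝ)

lemma contract_mem_inDegree {k : ℕ} {a : GForm V} (ha : a ∈ inDegree V (k + 1)) (x : V) :
    contract x a ∈ inDegree V k := by
  intro l hl
  rw [contract_apply, ha (l + 1) (by omega)]
  rfl

lemma pullback_mem_inDegree {k : ℕ} {a : GForm W} (ha : a ∈ inDegree W k) (L : V →L[ℝ] W) :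
    pullback L a ∈ inDegree V k := by
  intro l hl
  rw [pullback_apply, ha l hl]
  rfl

/-- The graded form with the single component `a`. -/
def ofDegree (k : ℕ) : (V [⋀^Fin k]→L[ℝ] ℝ) →ₗ[ℝ] GForm V :=
  LinearMap.single ℝ (fun k => V [⋀^Fin k]→L[ℝ] ℝ) k

@[simp] lemma ofDegree_same (k : ℕ) (a : V [⋀^Fin k]→L[ℝ] ℝ) : ofDegree k a k = a := by
  simp [ofDegree]

lemma ofDegree_mem (k : ℕ) (a : V [⋀^Fin k]→L[ℝ] ℝ) : ofDegree k a ∈ inDegree V k := by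
  intro l hl
  simp [ofDegree, hl]

lemma ofDegree_eq_self {k : ℕ} {a : GForm V} (ha : a ∈ inDegree V k) : ofDegree k (a k) = a := by
  funext l
  by_cases hl : l = k
  · subst hl; simp
  · rw [ha l hl, ofDegree_mem k (a k) l hl]

lemma wedge_ofDegree (ξ : V →L[ℝ] ℝ) (k : ℕ) (a : V [⋀^Fin k]→L[ℝ] ℝ) :
    wedge ξ (ofDegree k a) = ofDegree (k + 1) (wedgeAlt ξ a) := by
  rw [← ofDegree_eq_self (wedge_mem_inDegree (ofDegree_mem k a) ξ)]
  simp

end GradedForms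

/-! ### Lifting forms from `ℝ^d` to `ℝ^(d+1)` and exactness for Bernstein coefficients. -/

section Barycentric

variable {d : ℕ} (T : Affine.Simplex ℝ (E d) d)

/-- The differential `dλ_i` of the barycentric coordinate `λ_i`. -/
def dbary (i : Fin (d + 1)) : E d →L[ℝ] ℝ :=
  LinearMap.toContinuousLinearMap ((vertexBasis T).coord i).linear

lemma bary_add (i : Fin (d + 1)) (x v : E d) : bary T i (x + v) = bary T i x + dbary T i v := by
  have := ((vertexBasis T).coord i).map_vadd x v
  simp only [vadd_eq_add] at this
  rw [bary, add_comm x v, this, bary, add_comm]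
  rfl

lemma bary_sub (i : Fin (d + 1)) (x y : E d) : dbary T i (x - y) = bary T i x - bary T i y := by
  have := bary_add T i y (x - y)
  rw [add_sub_cancel] at this
  rw [this, add_sub_cancel_left]

lemma bary_points (i j : Fin (d + 1)) : bary T i (T.points j) = if i = j then 1 else 0 :=
  (vertexBasis T).coord_apply i j

lemma dbary_edge (i j l : Fin (d + 1)) : dbary T i (T.points j - T.points l)
    = (if i = j then 1 else 0) - if i = l then 1 else 0 := by
  rw [bary_sub, bary_points, bary_points]

lemma sum_bary (x : E d) : ∑ i, bary T i x = 1 := (vertexBasis T).sum_coord_apply_eq_one x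

lemma sum_bary_smul (x : E d) : ∑ i, bary T i x • T.points i = x :=
  (vertexBasis T).linear_combination_coord_eq_self x

lemma sum_dbary : ∑ i, dbary T i = 0 := by
  ext v
  have := sum_bary T (0 + v)
  simp only [bary_add, Finset.sum_add_distrib, sum_bary] at this
  simpa using this

lemma sum_dbary_apply (v : E d) : ∑ i, dbary T i v = 0 := by
  simpa using DFunLike.congr_fun (sum_dbary T) v

lemma sum_dbary_smul (j : Fin (d + 1)) (v : E d) :
    ∑ i, dbary T i v • (T.points i - T.points j) = v := by
  simp only [smul_sub, Finset.sum_sub_distrib, ← Finset.sum_smul, sum_dbary_apply, zero_smul,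
    sub_zero]
  have h1 := sum_bary_smul T (0 + v)
  have h0 := sum_bary_smul T 0
  simp only [bary_add, add_smul, Finset.sum_add_distrib, h0] at h1
  simpa using h1

/-- The linear map with the components `dλ_i`. -/
def coordMap : E d →L[ℝ] (Fin (d + 1) → ℝ) := ContinuousLinearMap.pi (dbary T)

/-- The linear map `e_i ↦ p_i - p_0`, a left inverse of `coordMap`. -/
def edgeMap : (Fin (d + 1) → ℝ) →L[ℝ] E d :=
  ∑ i, (ContinuousLinearMap.proj (R := ℝ) (φ := fun _ : Fin (d + 1) => ℝ) i).smulRight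
    (T.points i - T.points 0)

lemma edgeMap_apply (y : Fin (d + 1) → ℝ) :
    edgeMap T y = ∑ i, y i • (T.points i - T.points 0) := by
  simp [edgeMap]

lemma edgeMap_comp_coordMap : (edgeMap T).comp (coordMap T) = ContinuousLinearMap.id ℝ (E d) := by
  ext1 v
  simpa [edgeMap_apply, coordMap] using sum_dbary_smul T 0 v

/-- Exterior multiplication by `dλ_i`. -/
def dbaryWedge (i : Fin (d + 1)) : GForm (E d) →ₗ[ℝ] GForm (E d) := wedge (dbary T i)

lemma dbaryWedge_anticomm (i j : Fin (d + 1)) (a : GForm (E d)) :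
    dbaryWedge T i (dbaryWedge T j a) = - dbaryWedge T j (dbaryWedge T i a) :=
  wedge_anticomm _ _ _

/-- Exterior multiplication by the coordinate `1`-form `dx_i` of `ℝ^(d+1)`. -/
def coordWedge (i : Fin (d + 1)) :
    GForm (Fin (d + 1) → ℝ) →ₗ[ℝ] GForm (Fin (d + 1) → ℝ) :=
  wedge (ContinuousLinearMap.proj (R := ℝ) (φ := fun _ : Fin (d + 1) => ℝ) i)

/-- Contraction with the `i`-th basis vector of `ℝ^(d+1)`. -/
def coordContract (i : Fin (d + 1)) :
    GForm (Fin (d + 1) → ℝ) →ₗ[ℝ] GForm (Fin (d + 1) → ℝ) := contract (Pi.single i 1)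

lemma isFermionic_coord : IsFermionic (coordWedge (d := d)) coordContract where
  ww _ _ _ := wedge_anticomm _ _ _
  cc _ _ _ := contract_anticomm _ _ _
  cw i j a := by
    rw [coordContract, coordWedge, contract_wedge]
    congr 1
    by_cases hij : i = j
    · simp [hij]
    · simp [hij, Ne.symm hij]

/-- The number operator acts on degree `l` as multiplication by `l`, so an eigenvector for `k` has
no component in any other degree. -/
lemma mem_numberSpace_coord (k : ℕ) (a : GForm (Fin (d + 1) → ℝ)) :
    a ∈ numberSpace (coordWedge (d := d)) coordContract k ↔ a ∈ inDegree _ k := by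
  have h := sum_wedge_contract (fun i : Fin (d + 1) => (Pi.single i 1 : Fin (d + 1) → ℝ))
    (fun i => ContinuousLinearMap.proj (R := ℝ) (φ := fun _ : Fin (d + 1) => ℝ) i) (fun x => by
      funext l
      simp [Finset.sum_apply, Pi.single_apply]) a
  rw [mem_numberSpace, mem_inDegree, funext_iff]
  refine forall_congr' fun l => ?_
  have hl : (∑ i, coordWedge i (coordContract i a)) l = (l : ℝ) • a l := h l
  have hs : ((l : ℝ) - k) • a l = (l : ℝ) • a l - (k : ℝ) • a l := by
    ext v
    simp [sub_mul]
  rw [hl, Pi.smul_apply, ← sub_eq_zero]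
  refine (Eq.congr_left hs.symm).trans ?_
  rw [smul_eq_zero, sub_eq_zero, Nat.cast_inj]
  tauto

/-- The sum of the coordinate `1`-forms of `ℝ^(d+1)`. -/
def sumForm (d : ℕ) : (Fin (d + 1) → ℝ) →L[ℝ] ℝ :=
  ∑ i, ContinuousLinearMap.proj (R := ℝ) (φ := fun _ : Fin (d + 1) => ℝ) i

lemma sum_coordWedge (a : GForm (Fin (d + 1) → ℝ)) :
    (∑ i, coordWedge (d := d) i) a = wedge (sumForm d) a := by
  rw [sumForm, wedge_sum_left, LinearMap.sum_apply]
  rfl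

/-- Modulo `∑ dx_i`, the pullback of `dλ_i` is `dx_i`; the correction at `i = 0` comes from
measuring edges from the vertex `p_0`. -/
lemma dbary_comp_edgeMap (i : Fin (d + 1)) : (dbary T i).comp (edgeMap T) =
    ContinuousLinearMap.proj (R := ℝ) (φ := fun _ : Fin (d + 1) => ℝ) i
      - (if i = 0 then (1 : ℝ) else 0) • sumForm d := by
  ext1 y
  simp only [ContinuousLinearMap.comp_apply, edgeMap_apply, map_sum, map_smul, dbary_edge, sumForm,
    _root_.sub_apply, _root_.smul_apply, _root_.sum_apply, ContinuousLinearMap.proj_apply,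
    smul_eq_mul, mul_sub, Finset.sum_sub_distrib]
  congr 1
  · simp
  · rw [← Finset.sum_mul, mul_comm]

lemma sumForm_comp_coordMap : (sumForm d).comp (coordMap T) = 0 := by
  ext1 v
  simpa [sumForm, coordMap] using sum_dbary_apply T v

/-- The embedding `a ↦ (∑ dx_i) ∧ ρ^* a` of the forms on `ℝ^d` into the forms on `ℝ^(d+1)`. -/
def liftForm : GForm (E d) →ₗ[ℝ] GForm (Fin (d + 1) → ℝ) :=
  wedge (sumForm d) ∘ₗ pullback (edgeMap T)

/-- A left inverse of `liftForm`. -/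
def lowerForm : GForm (Fin (d + 1) → ℝ) →ₗ[ℝ] GForm (E d) :=
  pullback (coordMap T) ∘ₗ coordContract 0

lemma wedge_self (ξ : (Fin (d + 1) → ℝ) →L[ℝ] ℝ) (a : GForm (Fin (d + 1) → ℝ)) :
    wedge ξ (wedge ξ a) = 0 := eq_zero_of_eq_neg_self (wedge_anticomm _ _ _)

lemma coordWedge_liftForm (i : Fin (d + 1)) (a : GForm (E d)) :
    coordWedge i (liftForm T a) = - liftForm T (dbaryWedge T i a) := by
  simp only [liftForm, LinearMap.comp_apply, dbaryWedge, pullback_wedge, dbary_comp_edgeMap,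
    wedge_sub_left, wedge_smul_left, map_sub, map_smul, wedge_self, smul_zero, sub_zero]
  exact wedge_anticomm _ _ _

lemma pullback_id (a : GForm (E d)) : pullback (ContinuousLinearMap.id ℝ (E d)) a = a := by
  funext k
  ext v
  rfl

lemma pullback_coordMap_wedge (a : GForm (Fin (d + 1) → ℝ)) :
    pullback (coordMap T) (wedge (sumForm d) a) = 0 := by
  rw [pullback_wedge, sumForm_comp_coordMap, wedge_zero_left]

lemma contract_wedge_sumForm (a : GForm (Fin (d + 1) → ℝ)) :
    coordContract 0 (wedge (sumForm d) a) = a - wedge (sumForm d) (coordContract 0 a) := by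
  rw [← sum_coordWedge, isFermionic_coord.c_sum_w, sum_coordWedge]

lemma lowerForm_liftForm (a : GForm (E d)) : lowerForm T (liftForm T a) = a := by
  simp only [lowerForm, liftForm, LinearMap.comp_apply, contract_wedge_sumForm, map_sub,
    pullback_coordMap_wedge, sub_zero]
  have : pullback (coordMap T) (pullback (edgeMap T) a)
      = pullback ((edgeMap T).comp (coordMap T)) a := rfl
  rw [this, edgeMap_comp_coordMap, pullback_id]

/-- If `σ ∧ b = 0`, then `b = σ ∧ ι_0 b`, which pulls back to zero along `coordMap` because `σ`
does. Hence the `δ_{0i} b` produced by moving `ι_0` past `dx_i` disappears. -/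
lemma dbaryWedge_lowerForm (i : Fin (d + 1)) (b : GForm (Fin (d + 1) → ℝ))
    (hb : wedge (sumForm d) b = 0) :
    dbaryWedge T i (lowerForm T b) = - lowerForm T (coordWedge i b) := by
  have hb' : pullback (coordMap T) b = 0 := by
    have h := contract_wedge_sumForm b
    rw [hb, map_zero, eq_comm, sub_eq_zero] at h
    rw [h, pullback_coordMap_wedge]
  have h1 : dbaryWedge T i (pullback (coordMap T) (coordContract 0 b))
      = pullback (coordMap T) (coordWedge i (coordContract 0 b)) := by
    rw [coordWedge, pullback_wedge]
    rfl
  have h2 := isFermionic_coord.cw 0 i b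
  simp only [lowerForm, LinearMap.comp_apply, h1, h2, map_sub]
  by_cases h0 : 0 = i <;> simp [h0, hb']

open BubbleComplex.Poly

/-- Exactness of the complex of bubble forms in terms of their Bernstein coefficients. -/
theorem exists_extD_dbaryWedge_eq {k r : ℕ} {u : Poly (Fin (d + 1)) (GForm (E d))}
    (hu : u ∈ tangential (dbaryWedge T) (inDegree (E d) (k + 1)) r)
    (hD : extD (dbaryWedge T) u = 0) (htop : k + 1 ≠ d ∨ factSum u = 0) :
    ∃ z ∈ tangential (dbaryWedge T) (inDegree (E d) k) (r + 1), extD (dbaryWedge T) z = u := by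
  -- `liftForm` raises the form degree by one, so a `(k + 1)`-form is lifted to degree `k + 2`; this
  -- is the top degree `d + 1` exactly when `k + 1 = d`.
  have key := isFermionic_coord (d := d).exists_extD_eq_of_sum_w_eq_zero (q := ((k + 1 + 1 : ℕ) : ℝ))
    (by push_cast; have : (0 : ℝ) ≤ k := Nat.cast_nonneg k; linarith) (r := r)
    (u := map (liftForm T) u) ?_ ?_ ?_ ?_
  · obtain ⟨z, hz, hz1, hz2⟩ := key
    have hz3 : ∀ α, wedge (sumForm d) (z α) = 0 := by
      intro α
      have := DFunLike.congr_fun hz1 α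
      simpa [sum_coordWedge] using this
    refine ⟨- map (lowerForm T) z, Submodule.neg_mem _ (map_mem_tangential hz (fun α => ?_)
      (fun α i h0 => ?_)), ?_⟩
    · have := (hz α).1
      have e : ((k + 1 + 1 : ℕ) : ℝ) - 1 = ((k + 1 : ℕ) : ℝ) := by push_cast; ring
      rw [e, mem_numberSpace_coord] at this
      exact pullback_mem_inDegree (contract_mem_inDegree this _) _
    · rw [dbaryWedge_lowerForm T i _ (hz3 α), h0, map_zero, neg_zero]
    · have e1 : extD (dbaryWedge T) (map (lowerForm T) z)
          = - map (lowerForm T) (extD coordWedge z) := by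
        simp only [extD_apply, map_sum, map_pderiv]
        rw [← Finset.sum_neg_distrib]
        refine Finset.sum_congr rfl fun i _ => ?_
        rw [← map_neg]
        congr 1
        ext1 α
        simp [dbaryWedge_lowerForm T i _ (hz3 α)]
      rw [map_neg, e1, neg_neg, hz2]
      ext1 α
      simp [lowerForm_liftForm]
  · refine map_mem_tangential hu (fun α => ?_) (fun α i h0 => ?_)
    · rw [mem_numberSpace_coord]
      exact wedge_mem_inDegree (pullback_mem_inDegree (hu α).1 _) _
    · rw [coordWedge_liftForm, h0, map_zero, neg_zero]
  · ext1 α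
    simp [sum_coordWedge, liftForm, wedge_self]
  · have := map_extD (f := liftForm T) (w := dbaryWedge T) (w' := coordWedge)
      (fun i a => by rw [coordWedge_liftForm, neg_neg]) u
    rw [hD, map_zero, eq_comm, neg_eq_zero] at this
    exact this
  · rcases htop with h | h
    · left
      rw [Fintype.card_fin, Ne, Nat.cast_inj]
      omega
    · right
      have := linearMap_eq_of_single (f := factSum ∘ₗ map (liftForm T))
        (g := liftForm T ∘ₗ factSum) (fun α a => by simp [factSum_single]) u
      simp only [LinearMap.comp_apply] at this
      rw [this, h, map_zero]

end Barycentric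

/-! ### From Bernstein coefficients to polynomial forms. -/

section Evaluation

open BubbleComplex.Poly

variable {d : ℕ} (T : Affine.Simplex ℝ (E d) d)

/-- The Bernstein monomial `∏ λ_i^{α_i}`. -/
def bernstein (α : Fin (d + 1) → ℕ) (x : E d) : ℝ := ∏ i, bary T i x ^ α i

lemma hasFDerivAt_bary (i : Fin (d + 1)) (x : E d) : HasFDerivAt (bary T i) (dbary T i) x := by
  have : bary T i = fun y => dbary T i y + bary T i 0 := by
    funext y
    have := bary_sub T i y 0
    rw [sub_zero] at this
    linarith
  rw [this]
  exact (dbary T i).hasFDerivAt.add_const _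

lemma continuous_bary (i : Fin (d + 1)) : Continuous (bary T i) :=
  continuous_iff_continuousAt.2 fun x => (hasFDerivAt_bary T i x).continuousAt

lemma continuous_bernstein (α : Fin (d + 1) → ℕ) : Continuous (bernstein T α) :=
  continuous_finsetProd _ fun i _ => (continuous_bary T i).pow _

lemma hasFDerivAt_bernstein (α : Fin (d + 1) → ℕ) (x : E d) :
    HasFDerivAt (bernstein T α)
      (∑ i, ((α i : ℝ) * bernstein T (α - Pi.single i 1) x) • dbary T i) x := by
  have h := HasFDerivAt.finsetProd (u := Finset.univ) (x := x)
    (fun i _ => (hasFDerivAt_bary T i x).pow (α i))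
  refine h.congr_fderiv (Finset.sum_congr rfl fun i _ => ?_)
  rw [smul_smul]
  congr 1
  rw [bernstein, ← Finset.mul_prod_erase Finset.univ _ (Finset.mem_univ i)]
  have : ∏ j ∈ Finset.univ.erase i, bary T j x ^ (α - Pi.single i 1 : Fin (d + 1) → ℕ) j
      = ∏ j ∈ Finset.univ.erase i, bary T j x ^ α j :=
    Finset.prod_congr rfl fun j hj => by simp [Finset.ne_of_mem_erase hj]
  rw [this]
  simp
  ring

/-- The polynomial `k`-form with given Bernstein coefficients. -/
def evalForm (k : ℕ) : Poly (Fin (d + 1)) (GForm (E d)) →ₗ[ℝ] Form d k :=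
  Finsupp.lsum ℝ fun α =>
    { toFun := fun a x => bernstein T α x • a k
      map_add' := fun a b => by funext x; simp
      map_smul' := fun c a => by funext x; simp [smul_comm c] }

lemma evalForm_single (k : ℕ) (α : Fin (d + 1) → ℕ) (a : GForm (E d)) :
    evalForm T k (Finsupp.single α a) = fun x => bernstein T α x • a k := by
  rw [evalForm, Finsupp.lsum_single]
  rfl

lemma evalForm_apply (k : ℕ) (u : Poly (Fin (d + 1)) (GForm (E d))) (x : E d) :
    evalForm T k u x = ∑ α ∈ u.support, bernstein T α x • u α k := by
  rw [evalForm, Finsupp.lsum_apply, Finsupp.sum, Finset.sum_apply]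
  rfl

lemma hasFDerivAt_evalForm_single (k : ℕ) (α : Fin (d + 1) → ℕ) (a : GForm (E d)) (x : E d) :
    HasFDerivAt (evalForm T k (Finsupp.single α a))
      ((∑ i, ((α i : ℝ) * bernstein T (α - Pi.single i 1) x) • dbary T i).smulRight (a k)) x := by
  rw [evalForm_single]
  exact (hasFDerivAt_bernstein T α x).smul_const (a k)

/-- Differentiability is proved in the same induction because additivity of `extDeriv` needs it. -/
lemma extDeriv_evalForm_aux (k : ℕ) (u : Poly (Fin (d + 1)) (GForm (E d))) :
    Differentiable ℝ (evalForm T k u) ∧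
      extDeriv (evalForm T k u) = evalForm T (k + 1) (extD (dbaryWedge T) u) := by
  induction u using Finsupp.induction_linear with
  | zero =>
    have h0 : (0 : Form d k) = fun _ => 0 := rfl
    rw [map_zero, map_zero, map_zero]
    refine ⟨differentiable_const _, ?_⟩
    funext x
    simp [extDeriv, h0]
    exact map_zero (ContinuousAlternatingMap.alternatizeUncurryFinCLM ℝ (E d) ℝ)
  | add u v hu hv =>
    rw [map_add, map_add, map_add, ← hu.2, ← hv.2]
    exact ⟨hu.1.add hv.1, funext fun x => extDeriv_add (hu.1 x) (hv.1 x)⟩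
  | single α a =>
    refine ⟨fun x => (hasFDerivAt_evalForm_single T k α a x).differentiableAt, funext fun x => ?_⟩
    rw [extDeriv, (hasFDerivAt_evalForm_single T k α a x).fderiv, extD_single, map_sum,
      Finset.sum_apply]
    have : ∀ ξ : E d →L[ℝ] ℝ,
      ContinuousAlternatingMap.alternatizeUncurryFin (ξ.smulRight (a k)) = wedgeAlt ξ (a k) :=
      fun ξ => rfl
    rw [this, wedgeAlt_sum_left]
    refine Finset.sum_congr rfl fun i _ => ?_
    rw [map_smul, evalForm_single, wedgeAlt_smul_left, Pi.smul_apply, smul_smul]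
    rfl

lemma extDeriv_evalForm (k : ℕ) (u : Poly (Fin (d + 1)) (GForm (E d))) :
    extDeriv (evalForm T k u) = evalForm T (k + 1) (extD (dbaryWedge T) u) :=
  (extDeriv_evalForm_aux T k u).2

lemma differentiable_evalForm (k : ℕ) (u : Poly (Fin (d + 1)) (GForm (E d))) :
    Differentiable ℝ (evalForm T k u) := (extDeriv_evalForm_aux T k u).1

lemma exists_bary_eq {w : Fin (d + 1) → ℝ} (hw : ∑ i, w i = 1) : ∃ x, ∀ i, bary T i x = w i :=
  ⟨Finset.univ.affineCombination ℝ (vertexBasis T) w, fun i =>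
    (vertexBasis T).coord_apply_combination_of_mem (Finset.mem_univ i) hw⟩

/-- The Bernstein monomials of a fixed degree are linearly independent. -/
lemma eq_zero_of_sum_bernstein_eq_zero {r : ℕ} (s : Finset (Fin (d + 1) → ℕ))
    (hs : ∀ α ∈ s, ∑ i, α i = r) (c : (Fin (d + 1) → ℕ) → ℝ)
    (h : ∀ x, ∑ α ∈ s, bernstein T α x * c α = 0) {α : Fin (d + 1) → ℕ} (hα : α ∈ s) :
    c α = 0 := by
  obtain ⟨P, hPdef⟩ : ∃ P : MvPolynomial (Fin (d + 1)) ℝ,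
    P = ∑ α ∈ s, MvPolynomial.monomial (Finsupp.equivFunOnFinite.symm α) (c α) := ⟨_, rfl⟩
  have hev : ∀ y : Fin (d + 1) → ℝ, MvPolynomial.eval y P = ∑ α ∈ s, (∏ i, y i ^ α i) * c α := by
    intro y
    simp only [hPdef, map_sum, MvPolynomial.eval_monomial]
    refine Finset.sum_congr rfl fun α _ => ?_
    rw [mul_comm, Finsupp.prod_fintype _ _ (fun i => pow_zero _)]
    simp
  -- A point with nonzero coordinate sum rescales to barycentric coordinates, where `P` vanishes by
  -- homogeneity and hypothesis. The extra factor takes care of the hyperplane where rescaling is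
  -- impossible.
  have hP : P * ∑ i, MvPolynomial.X i = 0 := by
    refine MvPolynomial.funext fun y => ?_
    rw [map_mul, map_sum, map_zero]
    simp only [MvPolynomial.eval_X]
    by_cases hy : ∑ i, y i = 0
    · rw [hy, mul_zero]
    · obtain ⟨x, hx⟩ := exists_bary_eq T (w := fun i => y i / ∑ i, y i)
        (by rw [← Finset.sum_div, div_self hy])
      have : MvPolynomial.eval y P = (∑ i, y i) ^ r * ∑ α ∈ s, bernstein T α x * c α := by
        rw [hev, Finset.mul_sum]
        refine Finset.sum_congr rfl fun α hα => ?_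
        rw [← mul_assoc, ← hs α hα, bernstein]
        congr 1
        rw [← Finset.prod_pow_eq_pow_sum, ← Finset.prod_mul_distrib]
        refine Finset.prod_congr rfl fun i _ => ?_
        rw [hx, ← mul_pow, mul_div_cancel₀ _ hy]
      rw [this, h, mul_zero, zero_mul]
  have hX : (∑ i, MvPolynomial.X i : MvPolynomial (Fin (d + 1)) ℝ) ≠ 0 := by
    intro h0
    have := congrArg (MvPolynomial.eval (Pi.single 0 1 : Fin (d + 1) → ℝ)) h0
    simp [map_sum] at this
  have hP0 : P = 0 := (mul_eq_zero.1 hP).resolve_right hX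
  have := congrArg (MvPolynomial.coeff (Finsupp.equivFunOnFinite.symm α)) hP0
  rw [hPdef, MvPolynomial.coeff_sum] at this
  simpa [MvPolynomial.coeff_monomial, hα] using this

lemma evalForm_injOn {k r : ℕ} {u : Poly (Fin (d + 1)) (GForm (E d))}
    (hu : u ∈ tangential (dbaryWedge T) (inDegree (E d) k) r) (h : evalForm T k u = 0) :
    u = 0 := by
  by_contra hne
  obtain ⟨α, hα⟩ := Finsupp.support_nonempty_iff.2 hne
  refine Finsupp.mem_support_iff.1 hα ?_
  rw [← ofDegree_eq_self (hu α).1]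
  have : u α k = 0 := by
    ext v
    refine eq_zero_of_sum_bernstein_eq_zero T u.support (r := r) (fun β hβ => ?_)
      (fun β => u β k v) (fun x => ?_) hα
    · by_contra h'
      exact Finsupp.mem_support_iff.1 hβ ((hu β).2.1 h')
    · have := congrArg (fun ω : Form d k => ω x v) h
      simpa [evalForm_apply] using this
  rw [this, map_zero]

end Evaluation

/-! ### The Hodge star as contraction of the volume form. -/

section HodgeStar

open ContinuousAlternatingMap

/-- The sum of a symmetric function over all tuples with distinct entries, in terms of the
increasing tuples. -/
lemma sum_eq_factorial_smul_sum_orderEmbedding {d m : ℕ} (g : (Fin m → Fin d) → ℝ)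
    (hperm : ∀ (π : Equiv.Perm (Fin m)) (τ : Fin m → Fin d), g (τ ∘ π) = g τ)
    (hinj : ∀ τ, ¬ Function.Injective τ → g τ = 0) :
    ∑ τ, g τ = (m.factorial : ℝ) * ∑ σ : Fin m ↪o Fin d, g σ := by
  classical
  have h1 : ∑ τ, g τ = ∑ τ with Function.Injective τ, g τ := by
    rw [Finset.sum_filter]
    refine Finset.sum_congr rfl fun τ _ => ?_
    split_ifs with h
    · rfl
    · exact hinj τ h
  have h2 : ∑ x : (Fin m ↪o Fin d) × Equiv.Perm (Fin m), g (x.1 ∘ x.2)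
      = ∑ τ with Function.Injective τ, g τ := by
    refine Finset.sum_bij (fun x _ => x.1 ∘ x.2) (fun x _ => ?_) (fun x _ y _ hxy => ?_)
      (fun τ hτ => ?_) (fun x _ => rfl)
    · simpa using x.1.injective.comp x.2.injective
    · have hr : Set.range x.1 = Set.range y.1 := by
        rw [← x.2.surjective.range_comp x.1, ← y.2.surjective.range_comp y.1, hxy]
      have h1 : x.1 = y.1 := OrderEmbedding.range_inj.1 hr
      refine Prod.ext h1 (Equiv.ext fun i => ?_)
      have := congrFun hxy i
      simp only [Function.comp_apply, h1] at this
      exact y.1.injective this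
    · have hτ' : Function.Injective τ := by simpa using hτ
      have hs : StrictMono (τ ∘ Tuple.sort τ) :=
        (Tuple.monotone_sort τ).strictMono_of_injective (hτ'.comp (Tuple.sort τ).injective)
      refine ⟨(OrderEmbedding.ofStrictMono _ hs, (Tuple.sort τ)⁻¹), Finset.mem_univ _, ?_⟩
      funext i
      simp
  rw [h1, ← h2, Fintype.sum_prod_type]
  simp only [hperm, Finset.sum_const, Finset.card_univ, Fintype.card_perm, Fintype.card_fin,
    nsmul_eq_mul, Finset.mul_sum]

variable {d m k : ℕ}

lemma sum_inner_single_smul (x : E d) :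
    ∑ j, x j • (EuclideanSpace.single j 1 : E d) = x := by
  have := (EuclideanSpace.basisFun (Fin d) ℝ).sum_repr x
  simpa using this

lemma multilinear_expand (f : MultilinearMap ℝ (fun _ : Fin m => E d) ℝ) (x : Fin m → E d) :
    f x = ∑ ρ : Fin m → Fin d, (∏ i, x i (ρ i)) * f (stdVec ρ) := by
  conv_lhs => rw [show x = fun i => ∑ j, x i j • (EuclideanSpace.single j 1 : E d) from
    funext fun i => (sum_inner_single_smul (x i)).symm]
  rw [f.map_sum]
  refine Finset.sum_congr rfl fun ρ _ => ?_
  rw [f.map_smul_univ (fun i => x i (ρ i)) fun i => (EuclideanSpace.single (ρ i) 1 : E d)]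
  rfl

/-- After expanding in the standard basis, both sides are double sums over pairs of tuples,
interchanged by the symmetry of the matrix of `L`. -/
lemma sum_stdVec_symmetric (f g : MultilinearMap ℝ (fun _ : Fin m => E d) ℝ) (L : E d → E d)
    (hL : ∀ x y, inner ℝ (L x) y = inner ℝ x (L y)) :
    ∑ τ : Fin m → Fin d, f (fun i => L (stdVec τ i)) * g (stdVec τ)
      = ∑ τ : Fin m → Fin d, f (stdVec τ) * g (fun i => L (stdVec τ i)) := by
  have hsym : ∀ a b : Fin d, L (EuclideanSpace.single a 1) b = L (EuclideanSpace.single b 1) a := by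
    intro a b
    have := hL (EuclideanSpace.single a 1) (EuclideanSpace.single b 1)
    rw [EuclideanSpace.inner_single_left, EuclideanSpace.inner_single_right] at this
    simpa using this
  have h1 : ∀ τ : Fin m → Fin d, f (fun i => L (stdVec τ i)) * g (stdVec τ) =
      ∑ ρ : Fin m → Fin d, (∏ i, L (EuclideanSpace.single (τ i) 1) (ρ i)) *
        (f (stdVec ρ) * g (stdVec τ)) := by
    intro τ
    rw [multilinear_expand f, Finset.sum_mul]
    exact Finset.sum_congr rfl fun ρ _ => mul_assoc _ _ _
  have h2 : ∀ τ : Fin m → Fin d, f (stdVec τ) * g (fun i => L (stdVec τ i)) =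
      ∑ ρ : Fin m → Fin d, (∏ i, L (EuclideanSpace.single (ρ i) 1) (τ i)) *
        (f (stdVec τ) * g (stdVec ρ)) := by
    intro τ
    rw [multilinear_expand g, Finset.mul_sum]
    refine Finset.sum_congr rfl fun ρ _ => ?_
    rw [← mul_assoc, ← mul_assoc, mul_comm (f _)]
    congr 2
    exact Finset.prod_congr rfl fun i _ => hsym _ _
  simp only [h1, h2]
  rw [Finset.sum_comm]

/-- The volume form of `ℝ^d`. -/
def volForm (d : ℕ) : E d [⋀^Fin d]→ₗ[ℝ] ℝ :=
  Matrix.detRowAlternating.compLinearMap (WithLp.linearEquiv 2 ℝ (Fin d → ℝ)).toLinearMap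

lemma volContract_apply (h : m + k = d) (u : Fin m → E d) (v : Fin k → E d) :
    volContract h u v = volForm d (join h u v) := rfl

lemma join_update_left (h : m + k = d) (u : Fin m → E d) (v : Fin k → E d) [DecidableEq (Fin m)]
    (i : Fin m) (x : E d) :
    join h (Function.update u i x) v
      = Function.update (join h u v) (Fin.cast h (Fin.castAdd k i)) x := by
  subst h
  funext j
  refine Fin.addCases (fun a => ?_) (fun a => ?_) j
  · by_cases hai : a = i
    · subst hai
      simp [join]
    · have hne : Fin.castAdd k a ≠ Fin.castAdd k i := by
        intro h'
        exact hai (by simpa using h')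
      simp [join, Function.update_of_ne hne, Function.update_of_ne hai]
  · have hne : Fin.natAdd m a ≠ Fin.castAdd k i := by
      intro h'
      have := congrArg Fin.val h'
      simp at this
      omega
    simp [join, Function.update_of_ne hne]

/-- The value of `volContract h u` at `v` as an alternating function of `u`. -/
def volContractLeft (h : m + k = d) (v : Fin k → E d) : E d [⋀^Fin m]→ₗ[ℝ] ℝ where
  toFun u := volForm d (join h u v)
  map_update_add' u i x y := by simp only [join_update_left, AlternatingMap.map_update_add]
  map_update_smul' u i c x := by simp only [join_update_left, AlternatingMap.map_update_smul]
  map_eq_zero_of_eq' u i j hij hne := by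
    refine (volForm d).map_eq_zero_of_eq (i := Fin.cast h (Fin.castAdd k i))
      (j := Fin.cast h (Fin.castAdd k j)) _ (by simp [join, hij]) ?_
    intro h'
    apply hne
    have := congrArg Fin.val h'
    ext
    simpa using this

lemma volContractLeft_apply (h : m + k = d) (u : Fin m → E d) (v : Fin k → E d) :
    volContractLeft h v u = volContract h u v := rfl

/-- The summand is a product of two alternating functions, hence symmetric in the tuple. Summing
over all tuples removes the ordering and makes multilinear expansion available. -/
lemma factorial_mul_hodgeStar (h : m + k = d) (ω : Alt d m) (v : Fin k → E d) :
    (m.factorial : ℝ) * hodgeStar h ω v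
      = ∑ τ : Fin m → Fin d, ω (stdVec τ) * volContractLeft h v (stdVec τ) := by
  rw [sum_eq_factorial_smul_sum_orderEmbedding
    (fun τ : Fin m → Fin d => ω (stdVec τ) * volContractLeft h v (stdVec τ))]
  · congr 1
    simp [hodgeStar, volContractLeft_apply]
  · intro π τ
    have h1 : (stdVec (τ ∘ π) : Fin m → E d) = stdVec τ ∘ π := rfl
    have h2 := ω.toAlternatingMap.map_perm (stdVec τ) π
    have h3 := (volContractLeft h v).map_perm (stdVec τ) π
    simp only [coe_toAlternatingMap] at h2
    rw [h1, h2, h3, smul_mul_smul_comm]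
    simp
  · intro τ hτ
    simp only [Function.Injective, not_forall] at hτ
    obtain ⟨i, j, hij, hne⟩ := hτ
    rw [ω.map_eq_zero_of_eq (stdVec τ) (i := i) (j := j) (by simp [stdVec, hij]) hne, zero_mul]

lemma curryLeft_volContract (h : m + (k + 1) = d) (h' : m + 1 + k = d) (u : Fin m → E d)
    (x : E d) : curryLeft (volContract h u) x
      = volContract h' (Fin.snoc u x : Fin (m + 1) → E d) := by
  ext v
  rw [curryLeft_apply_apply, volContract_apply, volContract_apply]
  congr 1
  funext i
  rw [join, join]
  have := Fin.append_right_cons u x v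
  exact (congrFun this (Fin.cast h.symm i)).trans rfl

lemma eq_zero_of_finrank_lt {V : Type*} [NormedAddCommGroup V] [NormedSpace ℝ V]
    [FiniteDimensional ℝ V] (hm : Module.finrank ℝ V < m) (a : V [⋀^Fin m]→L[ℝ] ℝ) : a = 0 := by
  ext v
  refine a.toAlternatingMap.map_linearDependent v fun hli => ?_
  have := hli.fintype_card_le_finrank
  rw [Fintype.card_fin] at this
  omega

/-- `ξ ∧ dx` is zero as a `(d + 1)`-form, and contracting with one more `u_l` preserves the
vanishing because `ξ(u_l) = 0`. -/
lemma wedgeAlt_volContract (ξ : E d →L[ℝ] ℝ) (h : m + k = d) (u : Fin m → E d)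
    (hu : ∀ l, ξ (u l) = 0) : wedgeAlt ξ (volContract h u) = 0 := by
  induction m generalizing k with
  | zero => exact eq_zero_of_finrank_lt (by simp; omega) _
  | succ m ih =>
    have h' : m + (k + 1) = d := by omega
    have h1 := ih h' (Fin.init u) (fun l => hu _)
    have h2 := curryLeft_wedgeAlt_succ ξ (volContract h' (Fin.init u)) (u (Fin.last m))
    rw [h1, hu, zero_smul, curryLeft_volContract h' h, Fin.snoc_init_self] at h2
    simpa using h2.symm

/-- The Gram determinant form `w ↦ det ⟨u_j, w_i⟩` on a subspace. -/
def gramForm (S : Submodule ℝ (E d)) (u : Fin m → E d) : S [⋀^Fin m]→L[ℝ] ℝ :=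
  { Matrix.detRowAlternating.compLinearMap
      (LinearMap.pi fun j => (innerₛₗ ℝ (u j)) ∘ₗ S.subtype : S →ₗ[ℝ] (Fin m → ℝ)) with
    cont := by
      refine Continuous.matrix_det (continuous_matrix fun i j => ?_)
      change Continuous fun w : Fin m → S => inner ℝ (u j) (w i : E d)
      fun_prop }

lemma gramForm_apply (S : Submodule ℝ (E d)) (u : Fin m → E d) (w : Fin m → S) :
    gramForm S u w = Matrix.det (Matrix.of fun i j => inner ℝ (u j) (w i : E d)) := rfl

/-- Expanding the Gram determinant over permutations, each of the `m!` permutations contributes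
`volContract h u`: its sign cancels that of the permuted vectors. The projection drops out since the
`u_l` lie in `S`. -/
lemma hodgeStar_gramForm (S : Submodule ℝ (E d)) (h : m + k = d) (u : Fin m → E d)
    (hu : ∀ l, u l ∈ S) :
    hodgeStar h ((gramForm S u).compContinuousLinearMap S.orthogonalProjectionOnto)
      = volContract h u := by
  ext v
  have hm : (m.factorial : ℝ) ≠ 0 := by positivity
  refine mul_left_cancel₀ hm ?_
  rw [factorial_mul_hodgeStar]
  have h1 : ∀ τ : Fin m → Fin d,
      (gramForm S u).compContinuousLinearMap S.orthogonalProjectionOnto (stdVec τ)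
        = ∑ π : Equiv.Perm (Fin m), (Equiv.Perm.sign π : ℝ) * ∏ i, u (π i) (τ i) := by
    intro τ
    rw [compContinuousLinearMap_apply, gramForm_apply, ← Matrix.det_transpose, Matrix.det_apply]
    refine Finset.sum_congr rfl fun π _ => ?_
    rw [Units.smul_def, zsmul_eq_mul]
    congr 1
    refine Finset.prod_congr rfl fun i _ => ?_
    have := S.inner_orthogonalProjectionOnto_eq_of_mem_left ⟨u (π i), hu _⟩ (stdVec τ i)
    simp only [Matrix.transpose_apply, Matrix.of_apply, Function.comp_apply]
    refine this.trans ?_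
    simp [stdVec, EuclideanSpace.inner_single_right]
  simp only [h1, Finset.sum_mul]
  rw [Finset.sum_comm]
  have h2 : ∀ π : Equiv.Perm (Fin m), ∑ τ : Fin m → Fin d,
      (Equiv.Perm.sign π : ℝ) * (∏ i, u (π i) (τ i)) * volContractLeft h v (stdVec τ)
        = volContract h u v := by
    intro π
    have := multilinear_expand (volContractLeft h v).toMultilinearMap (u ∘ π)
    simp only [AlternatingMap.coe_multilinearMap] at this
    simp only [mul_assoc]
    rw [← Finset.mul_sum]
    have e : ∑ τ : Fin m → Fin d, (∏ i, u (π i) (τ i)) * volContractLeft h v (stdVec τ)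
        = volContractLeft h v (u ∘ π) := this.symm
    rw [e, AlternatingMap.map_perm, Units.smul_def, zsmul_eq_mul, ← mul_assoc,
      volContractLeft_apply, ← Int.cast_mul, ← Units.val_mul, Int.units_mul_self]
    simp
  simp only [h2, Finset.sum_const, Finset.card_univ, Fintype.card_perm, Fintype.card_fin,
    nsmul_eq_mul]

/-- The form sees its arguments only through the orthogonal projection, which is symmetric and can
therefore be moved onto the vectors contracted into the volume form. -/
lemma hodgeStar_mem_span (S : Submodule ℝ (E d)) (h : m + k = d) (η : S [⋀^Fin m]→L[ℝ] ℝ) :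
    hodgeStar h (η.compContinuousLinearMap S.orthogonalProjectionOnto)
      ∈ Submodule.span ℝ {a | ∃ u : Fin m → E d, (∀ l, u l ∈ S) ∧ a = volContract h u} := by
  set ω : Alt d m := η.compContinuousLinearMap S.orthogonalProjectionOnto with hω
  let L : E d → E d := fun x => (S.orthogonalProjectionOnto x : E d)
  have hL : ∀ x y, inner ℝ (L x) y = inner ℝ x (L y) := by
    intro x y
    rw [← S.inner_orthogonalProjectionOnto_eq_of_mem_left (S.orthogonalProjectionOnto x) y,
      ← S.inner_orthogonalProjectionOnto_eq_of_mem_right (S.orthogonalProjectionOnto y) x]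
  have hωL : ∀ x : Fin m → E d, ω x = ω fun i => L (x i) := by
    intro x
    rw [hω, compContinuousLinearMap_apply, compContinuousLinearMap_apply]
    congr 1
    funext i
    exact (S.orthogonalProjectionOnto_mem_subspace_eq_self _).symm
  have key : (m.factorial : ℝ) • hodgeStar h ω = ∑ τ : Fin m → Fin d,
      ω (stdVec τ) • volContract h (fun i => L (stdVec τ i)) := by
    ext v
    rw [ContinuousAlternatingMap.smul_apply, smul_eq_mul, factorial_mul_hodgeStar]
    have h1 : ∑ τ : Fin m → Fin d, ω (fun i => L (stdVec τ i)) * volContractLeft h v (stdVec τ)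
        = ∑ τ : Fin m → Fin d, ω (stdVec τ) * volContractLeft h v (fun i => L (stdVec τ i)) :=
      sum_stdVec_symmetric ω.toAlternatingMap.toMultilinearMap
        (volContractLeft h v).toMultilinearMap L hL
    rw [Finset.sum_congr rfl fun τ _ => by rw [hωL (stdVec τ)], h1,
      ContinuousAlternatingMap.sum_apply]
    rfl
  have hm : (m.factorial : ℝ) ≠ 0 := by positivity
  rw [← Submodule.smul_mem_iff _ hm, key]
  refine Submodule.sum_mem _ fun τ _ => Submodule.smul_mem _ _ (Submodule.subset_span ?_)
  exact ⟨_, fun l => Subtype.coe_prop _, rfl⟩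

end HodgeStar

/-! ### Bubble spaces in terms of Bernstein coefficients. -/

section Bubble

open ContinuousAlternatingMap BubbleComplex.Poly

variable {d : ℕ} (T : Affine.Simplex ℝ (E d) d)

lemma volContract_stdVec (h : 0 + d = d) :
    volContract h (fun l : Fin 0 => (l.elim0 : E d)) (stdVec id) = 1 := by
  rw [volContract_apply]
  have hj : join h (fun l : Fin 0 => (l.elim0 : E d)) (stdVec id) = stdVec id := by
    funext i
    have : Fin.cast h.symm i = Fin.natAdd 0 i := by
      ext
      simp
    rw [join, this, Fin.append_right]
  rw [hj]
  have : (Matrix.of fun i j => (stdVec id : Fin d → E d) i j) = 1 := by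
    ext i j
    simp [stdVec, Matrix.one_apply, eq_comm]
  change Matrix.det (Matrix.of fun i j => (stdVec id : Fin d → E d) i j) = 1
  rw [this, Matrix.det_one]

lemma eq_smul_volContract (h : 0 + d = d) (a : Alt d d) :
    a = a (stdVec id) • volContract h (fun l => l.elim0) := by
  have h1 := a.toAlternatingMap.eq_smul_basis_det (EuclideanSpace.basisFun (Fin d) ℝ).toBasis
  have h2 := (volContract h (fun l : Fin 0 => (l.elim0 : E d))).toAlternatingMap.eq_smul_basis_det
    (EuclideanSpace.basisFun (Fin d) ℝ).toBasis
  have hb : ((EuclideanSpace.basisFun (Fin d) ℝ).toBasis : Fin d → E d) = stdVec id := by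
    funext i
    simp [stdVec]
  rw [hb, coe_toAlternatingMap, volContract_stdVec h, one_smul] at h2
  rw [hb, coe_toAlternatingMap] at h1
  apply toAlternatingMap_injective
  rw [h1]
  conv_lhs => rw [← h2]
  rfl

/-- The span of the forms `dx(u_1, …, u_m, ·, …, ·)` with `dλ_i(u_l) = 0` for `i ∈ A`. -/
def contractSpan (A : Finset (Fin (d + 1))) {m k : ℕ} (h : m + k = d) : Submodule ℝ (Alt d k) :=
  Submodule.span ℝ {a | ∃ u : Fin m → E d, (∀ l, ∀ i ∈ A, dbary T i (u l) = 0) ∧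
    a = volContract h u}

lemma contractSpan_anti {A B : Finset (Fin (d + 1))} (hAB : A ⊆ B) {m k : ℕ} (h : m + k = d) :
    contractSpan T B h ≤ contractSpan T A h := by
  refine Submodule.span_mono ?_
  rintro a ⟨u, hu, rfl⟩
  exact ⟨u, fun l i hi => hu l i (hAB hi), rfl⟩

lemma curryLeft_mem_contractSpan {A : Finset (Fin (d + 1))} {m k : ℕ} (h : m + (k + 1) = d)
    (h' : m + 1 + k = d) {x : E d} (hx : ∀ i ∈ A, dbary T i x = 0) {b : Alt d (k + 1)}
    (hb : b ∈ contractSpan T A h) : curryLeft b x ∈ contractSpan T A h' := by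
  induction hb using Submodule.span_induction with
  | mem b hb =>
    obtain ⟨u, hu, rfl⟩ := hb
    rw [curryLeft_volContract h h']
    refine Submodule.subset_span ⟨_, fun l i hi => ?_, rfl⟩
    refine Fin.lastCases ?_ (fun l => ?_) l
    · simpa using hx i hi
    · simpa using hu l i hi
  | zero => simp
  | add b c _ _ hb hc =>
    rw [curryLeft_add]
    exact Submodule.add_mem _ hb hc
  | smul c b _ hb =>
    rw [curryLeft_smul]
    exact Submodule.smul_mem _ _ hb

/-- A form annihilated by the `dλ_i`, `i ∈ A`, is a combination of contractions of the volume
form with vectors on which the `dλ_i` vanish. -/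
lemma mem_contractSpan_of_wedge {j : Fin (d + 1)} (n : ℕ) :
    ∀ (A : Finset (Fin (d + 1))), j ∉ A → A.card + n = d → ∀ {m k : ℕ} (h : m + k = d)
      (a : GForm (E d)), a ∈ inDegree (E d) k → (∀ i ∈ A, dbaryWedge T i a = 0) →
      a k ∈ contractSpan T A h := by
  induction n with
  | zero =>
    intro A hj hA m k h a ha hw
    have hA' : ∀ i, i ≠ j → i ∈ A := by
      have : A = Finset.univ.erase j := by
        refine Finset.eq_of_subset_of_card_le (fun i hi => ?_) ?_
        · simp only [Finset.mem_erase, Finset.mem_univ, and_true]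
          rintro rfl
          exact hj hi
        · rw [Finset.card_erase_of_mem (Finset.mem_univ _)]
          simp
          omega
      intro i hi
      rw [this]
      simp [hi]
    -- Here `A` contains every index but `j`. Each `dλ_i ∧ ι_{p_i - p_j} a` with `i ≠ j` equals `a`,
    -- so the number operator gives `d a_k = k a_k`, and `a_k` vanishes unless `k = d`.
    have hs := sum_wedge_contract (fun i => T.points i - T.points j) (dbary T)
      (sum_dbary_smul T j) a k
    have ht : ∀ i, wedge (dbary T i) (contract (T.points i - T.points j) a)
        = (1 - if i = j then (1 : ℝ) else 0) • a := by
      intro i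
      by_cases hij : i = j
      · subst hij
        have : contract (0 : E d) a = 0 := by
          funext l
          simp
        rw [sub_self, this, _root_.map_zero]
        simp
      · have h1 := contract_wedge (dbary T i) (T.points i - T.points j) a
        have h2 : wedge (dbary T i) a = 0 := hw i (hA' i hij)
        rw [h2, _root_.map_zero, dbary_edge, eq_comm, sub_eq_zero] at h1
        rw [← h1, if_pos rfl]
    simp only [ht] at hs
    rw [← Finset.sum_smul, Pi.smul_apply] at hs
    have hd : ∑ i : Fin (d + 1), (1 - if i = j then (1 : ℝ) else 0) = d := by simp
    rw [hd] at hs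
    by_cases hk : k = d
    · subst hk
      obtain rfl : m = 0 := by omega
      rw [eq_smul_volContract h (a k)]
      exact Submodule.smul_mem _ _ (Submodule.subset_span ⟨_, fun l => l.elim0, rfl⟩)
    · have h0 : ((d : ℝ) - k) • a k = 0 := by
        ext v
        have := congrArg (fun b : Alt d k => b v) hs
        simp only [ContinuousAlternatingMap.smul_apply, smul_eq_mul] at this
        simp [sub_mul, this]
      have hne : (d : ℝ) - k ≠ 0 := sub_ne_zero.2 (fun h' => hk (Nat.cast_injective h').symm)
      rw [(smul_eq_zero.1 h0).resolve_left hne]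
      exact Submodule.zero_mem _
  | succ n ih =>
    intro A hj hA m k h a ha hw
    obtain ⟨i, hiA, hij⟩ : ∃ i, i ∉ A ∧ i ≠ j := by
      by_contra! hc
      have : (insert j A).card = d + 1 := by
        have : insert j A = Finset.univ := by
          refine Finset.eq_univ_of_forall fun i => ?_
          by_cases hi : i ∈ A
          · exact Finset.mem_insert_of_mem hi
          · rw [hc i hi]
            exact Finset.mem_insert_self _ _
        rw [this]
        simp
      rw [Finset.card_insert_of_notMem hj] at this
      omega
    have hj' : j ∉ insert i A := by
      simp [hj, Ne.symm hij]
    have hA' : (insert i A).card + n = d := by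
      rw [Finset.card_insert_of_notMem hiA]
      omega
    set x := T.points i - T.points j with hx
    have hxi : dbary T i x = 1 := by
      rw [hx, dbary_edge]
      simp [hij]
    have hxA : ∀ l ∈ A, dbary T l x = 0 := by
      intro l hl
      have h1 : l ≠ i := fun h => hiA (h ▸ hl)
      have h2 : l ≠ j := fun h => hj (h ▸ hl)
      rw [hx, dbary_edge, if_neg h1, if_neg h2, sub_zero]
    -- The edge `x = p_i - p_j` satisfies `dλ_i(x) = 1` and is invisible to the `dλ_l`, `l ∈ A`.
    -- Thus `dλ_i ∧ a` and `dλ_i ∧ ι_x a` are both annihilated on the larger set `insert i A`, and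
    -- contracting the former with `x` stays in the span for `A`.
    have hdec : a = contract x (dbaryWedge T i a) + dbaryWedge T i (contract x a) := by
      have := contract_wedge (dbary T i) x a
      rw [hxi, one_smul] at this
      rw [dbaryWedge, this, sub_add_cancel]
    have hself : ∀ b, dbaryWedge T i (dbaryWedge T i b) = 0 := fun b =>
      eq_zero_of_eq_neg_self (dbaryWedge_anticomm T i i b)
    rw [hdec]
    refine Submodule.add_mem _ ?_ ?_
    · have hdeg : dbaryWedge T i a ∈ inDegree (E d) (k + 1) := wedge_mem_inDegree ha _
      match m, h with
      | 0, h =>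
        rw [contract_apply, eq_zero_of_finrank_lt (by simp; omega) (dbaryWedge T i a (k + 1))]
        exact Submodule.zero_mem _
      | m + 1, h =>
        have h' : m + (k + 1) = d := by omega
        refine curryLeft_mem_contractSpan T h' h hxA ?_
        refine contractSpan_anti T (Finset.subset_insert i A) h' ?_
        refine ih (insert i A) hj' hA' h' _ hdeg fun l hl => ?_
        rcases Finset.mem_insert.1 hl with rfl | hl
        · exact hself a
        · rw [dbaryWedge_anticomm, hw l hl, _root_.map_zero, neg_zero]
    · refine contractSpan_anti T (Finset.subset_insert i A) h ?_
      refine ih (insert i A) hj' hA' h _ ?_ fun l hl => ?_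
      · have : dbaryWedge T i (contract x a) = a - contract x (dbaryWedge T i a) := by
          rw [eq_sub_iff_add_eq, add_comm]
          exact hdec.symm
        rw [this]
        exact Submodule.sub_mem _ ha (contract_mem_inDegree (wedge_mem_inDegree ha _) _)
      · rcases Finset.mem_insert.1 hl with rfl | hl
        · exact hself _
        · have h1 := contract_wedge (dbary T l) x a
          have h2 : wedge (dbary T l) a = 0 := hw l hl
          rw [h2, hxA l hl, zero_smul, zero_sub, _root_.map_zero, eq_comm, neg_eq_zero] at h1
          have h3 : dbaryWedge T l (contract x a) = 0 := h1
          rw [dbaryWedge_anticomm, h3, _root_.map_zero, neg_zero]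

/-- With `j ∈ f`, the expansion `v = ∑ dλ_i(v) (p_i - p_j)` uses only edges of `f` precisely when
the other `dλ_i(v)` vanish. -/
lemma mem_tangentSpace_iff {f : Finset (Fin (d + 1))} (hf : f.Nonempty) (v : E d) :
    v ∈ tangentSpace T f ↔ ∀ i ∉ f, dbary T i v = 0 := by
  obtain ⟨j, hj⟩ := hf
  rw [tangentSpace, vectorSpan_eq_span_vsub_set_right ℝ (Set.mem_image_of_mem T.points (Finset.mem_coe.2 hj))]
  constructor
  · intro hv i hi
    induction hv using Submodule.span_induction with
    | mem v hv =>
      obtain ⟨_, ⟨l, hl, rfl⟩, rfl⟩ := hv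
      have h1 : i ≠ l := fun h => hi (h ▸ hl)
      have h2 : i ≠ j := fun h => hi (h ▸ hj)
      simp only [vsub_eq_sub]
      rw [dbary_edge, if_neg h1, if_neg h2, sub_zero]
    | zero => simp
    | add x y _ _ hx hy => rw [map_add, hx, hy, add_zero]
    | smul c x _ hx => rw [map_smul, hx, smul_zero]
  · intro hv
    rw [← sum_dbary_smul T j v]
    refine Submodule.sum_mem _ fun i _ => ?_
    by_cases hi : i ∈ f
    · exact Submodule.smul_mem _ _ (Submodule.subset_span ⟨_, ⟨i, hi, rfl⟩, rfl⟩)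
    · rw [hv i hi, zero_smul]
      exact Submodule.zero_mem _

/-- The forms `⋆ Π_f^* η` are the forms annihilated by the `dλ_i`, `i ∉ f`. -/
lemma exists_hodgeStar_extendAlt_iff {f : Finset (Fin (d + 1))} (hf : f.Nonempty) {m k : ℕ}
    (h : m + k = d) (a : Alt d k) :
    (∃ η : tangentSpace T f [⋀^Fin m]→L[ℝ] ℝ, a = hodgeStar h (extendAlt T f η)) ↔
      ∀ i ∉ f, wedgeAlt (dbary T i) a = 0 := by
  constructor
  · rintro ⟨η, rfl⟩ i hi
    have := hodgeStar_mem_span (tangentSpace T f) h η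
    rw [extendAlt]
    generalize hodgeStar h (η.compContinuousLinearMap
      (tangentSpace T f).orthogonalProjectionOnto) = a at this
    induction this using Submodule.span_induction with
    | mem a ha =>
      obtain ⟨u, hu, rfl⟩ := ha
      exact wedgeAlt_volContract _ h u fun l => (mem_tangentSpace_iff T hf _).1 (hu l) i hi
    | zero => simpa using wedgeAlt_smul 0 (dbary T i) (0 : Alt d k)
    | add a b _ _ ha hb => rw [wedgeAlt_add, ha, hb, add_zero]
    | smul c a _ ha => rw [wedgeAlt_smul, ha, smul_zero]
  · intro ha
    obtain ⟨j, hj⟩ := hf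
    have h1 := mem_contractSpan_of_wedge T (j := j) (d - fᶜ.card) fᶜ (by simp [hj])
      (by
        have : fᶜ.card < d + 1 := by
          simpa using Finset.card_lt_univ_of_notMem (s := fᶜ) (x := j) (by simp [hj])
        omega) h (ofDegree k a) (ofDegree_mem k a)
      (fun i hi => by
        rw [dbaryWedge, wedge_ofDegree, ha i (by simpa using hi), _root_.map_zero])
    rw [ofDegree_same] at h1
    clear ha
    induction h1 using Submodule.span_induction with
    | mem a ha =>
      obtain ⟨u, hu, rfl⟩ := ha
      -- The Gram form of vectors tangent to `f` has the contraction by these vectors as its Hodge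
      -- star.
      refine ⟨gramForm (tangentSpace T f) u, (hodgeStar_gramForm _ h u fun l => ?_).symm⟩
      exact (mem_tangentSpace_iff T ⟨j, hj⟩ _).2 fun i hi => hu l i (by simpa using hi)
    | zero => exact ⟨0, by ext v; simp [hodgeStar, extendAlt]⟩
    | add a b _ _ ha hb =>
      obtain ⟨η, rfl⟩ := ha
      obtain ⟨η', rfl⟩ := hb
      exact ⟨η + η', by ext v; simp [hodgeStar, extendAlt, add_mul, Finset.sum_add_distrib]⟩
    | smul c a _ ha =>
      obtain ⟨η, rfl⟩ := ha
      exact ⟨c • η, by ext v; simp [hodgeStar, extendAlt, Finset.mul_sum, mul_assoc]⟩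

lemma facePoly_eq_bot (f : Finset (Fin (d + 1))) {m : ℤ} (hm : m < 0) : facePoly T f m = ⊥ := by
  rw [facePoly, Submodule.span_eq_bot]
  rintro p ⟨α, hα, -⟩
  omega

/-- Each face in the sum has at least `d - k + 1` vertices, so its polynomial factor would have
negative degree. -/
lemma bubble_eq_bot {r : ℤ} {k : ℕ} (hk : k ≤ d) (hr : r < d - k + 1) :
    bubble T r k hk = ⊥ := by
  rw [bubble, iSup_eq_bot]
  rintro ⟨f, hf⟩
  rw [Submodule.span_eq_bot]
  rintro ω ⟨p, hp, η, rfl⟩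
  rw [facePoly_eq_bot T f (by simp only; omega), Submodule.mem_bot] at hp
  funext x
  simp [hp]

lemma prod_mul_faceBubble (f : Finset (Fin (d + 1))) (α : Fin (d + 1) → ℕ) (x : E d) :
    (∏ i ∈ f, bary T i x ^ α i) * faceBubble T f x
      = bernstein T (fun i => if i ∈ f then α i + 1 else 0) x := by
  rw [faceBubble, ← Finset.prod_mul_distrib, bernstein,
    ← Finset.prod_subset (Finset.subset_univ f) (fun i _ hi => by simp [hi])]
  exact Finset.prod_congr rfl fun i hi => by simp [hi, pow_succ]

/-- The bubble forms are the forms with Bernstein coefficients `a_α` such that `dλ_i ∧ a_α = 0`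
whenever `α_i = 0`. -/
lemma bubble_eq_map {r k : ℕ} (hr : r ≠ 0) (hk : k ≤ d) :
    bubble T r k hk
      = (tangential (dbaryWedge T) (inDegree (E d) k) r).map (evalForm T k) := by
  apply le_antisymm
  · refine iSup_le ?_
    rintro ⟨f, hf⟩
    rw [Submodule.span_le]
    rintro ω ⟨p, hp, η, rfl⟩
    simp only at hp hf
    have hne : f.Nonempty := Finset.card_pos.1 (by omega)
    set a := hodgeStar (Nat.sub_add_cancel hk) (extendAlt T f η) with ha
    have hw := (exists_hodgeStar_extendAlt_iff T hne (Nat.sub_add_cancel hk) a).1 ⟨η, ha⟩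
    change (fun x => (p x * faceBubble T f x) • a) ∈
      (tangential (dbaryWedge T) (inDegree (E d) k) r).map (evalForm T k)
    induction hp using Submodule.span_induction with
    | mem p hp =>
      obtain ⟨α, hα, rfl⟩ := hp
      -- The bubble `b_f` raises every exponent on `f` by one, so the resulting `α` has support
      -- exactly `f`.
      refine ⟨Finsupp.single (fun i => if i ∈ f then α i + 1 else 0) (ofDegree k a),
        single_mem_tangential (ofDegree_mem k a) ?_ (fun i hi => ?_), ?_⟩
      · rw [← Finset.sum_subset (Finset.subset_univ f) (fun i _ hi => by simp [hi]),
          Finset.sum_congr rfl (fun i hi => if_pos hi), Finset.sum_add_distrib]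
        simp
        omega
      · have hif : i ∉ f := fun h => by simp [h] at hi
        rw [dbaryWedge, wedge_ofDegree, hw i hif, _root_.map_zero]
      · rw [evalForm_single, ofDegree_same]
        funext x
        simp only
        rw [prod_mul_faceBubble]
    | zero =>
      convert Submodule.zero_mem _
      simp
    | add p q _ _ hp hq =>
      convert Submodule.add_mem _ hp hq using 1
      funext x
      simp [add_mul, add_smul]
    | smul c p _ hp =>
      convert Submodule.smul_mem _ c hp using 1
      funext x
      simp [mul_assoc, mul_smul]
  · rintro _ ⟨u, hu, rfl⟩
    refine map_mem_of_tangential _ _ hu fun α a ha hα hw => ?_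
    rw [evalForm_single]
    set f : Finset (Fin (d + 1)) := Finset.univ.filter (fun i => α i ≠ 0) with hf
    have hmem : ∀ i, i ∈ f ↔ α i ≠ 0 := fun i => by simp [hf]
    have hsum : ∑ i ∈ f, α i = r := by
      rw [← hα]
      exact Finset.sum_subset (Finset.subset_univ f)
        (fun i _ hi => by simpa [hmem] using hi)
    -- This is where `r ≠ 0` enters: `α = 0` would have empty support, and the empty set is not a
    -- face.
    have hne : f.Nonempty := by
      rw [Finset.nonempty_iff_ne_empty]
      intro h
      rw [h, Finset.sum_empty] at hsum
      exact hr hsum.symm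
    obtain ⟨η, hη⟩ := (exists_hodgeStar_extendAlt_iff T hne (Nat.sub_add_cancel hk) (a k)).2
      (fun i hi => by
        have h0 : α i = 0 := by simpa [hmem] using hi
        have := congrFun (hw i h0) (k + 1)
        exact this)
    by_cases hcard : d - k + 1 ≤ f.card
    · refine Submodule.mem_iSup_of_mem ⟨f, hcard⟩ (Submodule.subset_span ?_)
      refine ⟨fun x => ∏ i ∈ f, bary T i x ^ (α i - 1),
        Submodule.subset_span ⟨fun i => α i - 1, ?_, rfl⟩, η, ?_⟩
      · have h1 : ∑ i ∈ f, (α i - 1) + f.card = r := by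
          rw [← hsum, Finset.card_eq_sum_ones, ← Finset.sum_add_distrib]
          refine Finset.sum_congr rfl fun i hi => ?_
          have := (hmem i).1 hi
          omega
        simp only
        omega
      · funext x
        simp only
        rw [prod_mul_faceBubble, ← hη]
        congr 2
        funext i
        by_cases hi : i ∈ f
        · have := (hmem i).1 hi
          simp [hi]
          omega
        · have h0 : α i = 0 := by
            by_contra h
            exact hi ((hmem i).2 h)
          simp [hi, h0]
    -- A face with at most `d - k` vertices does not occur in the bubble sum, but its tangent space
    -- has dimension less than `d - k`, so its coefficient is zero anyway.
    · have hη0 : η = 0 := by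
        refine eq_zero_of_finrank_lt ?_ η
        classical
        have h1 := finrank_vectorSpan_image_finset_le ℝ T.points f (n := f.card - 1)
          (by have := hne.card_pos; omega)
        rw [Finset.coe_image] at h1
        have := hne.card_pos
        exact lt_of_le_of_lt h1 (by omega)
      have ha0 : a k = 0 := by
        rw [hη, hη0]
        ext v
        simp [hodgeStar, extendAlt]
      rw [ha0]
      simp only [smul_zero]
      exact Submodule.zero_mem _

end Bubble

/-! ### Divergence theorem on the simplex by translation invariance. -/

section Integral

open Filter Topology

/-- A product of numbers of absolute value at most one is Lipschitz in its factors. -/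
lemma abs_prod_sub_prod_le {κ : Type*} (s : Finset κ) (a b : κ → ℝ) (ha : ∀ i, |a i| ≤ 1)
    (hb : ∀ i, |b i| ≤ 1) : |∏ i ∈ s, a i - ∏ i ∈ s, b i| ≤ ∑ i ∈ s, |a i - b i| := by
  classical
  induction s using Finset.induction_on with
  | empty => simp
  | insert i s hi ih =>
    rw [Finset.prod_insert hi, Finset.prod_insert hi, Finset.sum_insert hi]
    have h1 : a i * ∏ j ∈ s, a j - b i * ∏ j ∈ s, b j
        = (a i - b i) * ∏ j ∈ s, a j + b i * (∏ j ∈ s, a j - ∏ j ∈ s, b j) := by ring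
    rw [h1]
    refine (abs_add_le _ _).trans (add_le_add ?_ ?_)
    · rw [abs_mul]
      refine mul_le_of_le_one_right (abs_nonneg _) ?_
      rw [Finset.abs_prod]
      exact Finset.prod_le_one (fun j _ => abs_nonneg _) fun j _ => ha j
    · rw [abs_mul]
      exact (mul_le_of_le_one_left (abs_nonneg _) (hb i)).trans ih

lemma abs_prod_pow_sub_prod_pow_le {κ : Type*} (s : Finset κ) (α : κ → ℕ) (a b : κ → ℝ)
    (ha : ∀ i, |a i| ≤ 1) (hb : ∀ i, |b i| ≤ 1) :
    |∏ i ∈ s, a i ^ α i - ∏ i ∈ s, b i ^ α i| ≤ ∑ i ∈ s, α i * |a i - b i| := by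
  refine (abs_prod_sub_prod_le s _ _ (fun i => ?_) (fun i => ?_)).trans
    (Finset.sum_le_sum fun i _ => ?_)
  · rw [abs_pow]
    exact pow_le_one₀ (abs_nonneg _) (ha i)
  · rw [abs_pow]
    exact pow_le_one₀ (abs_nonneg _) (hb i)
  · simpa using abs_prod_sub_prod_le (Finset.range (α i)) (fun _ => a i) (fun _ => b i)
      (fun _ => ha i) (fun _ => hb i)

variable {d : ℕ} (T : Affine.Simplex ℝ (E d) d)

lemma mem_simplex_iff (x : E d) :
    x ∈ convexHull ℝ (Set.range T.points) ↔ ∀ i, 0 ≤ bary T i x := by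
  have := (vertexBasis T).convexHull_eq_nonneg_coord
  exact Set.ext_iff.1 this x

lemma isCompact_simplex : IsCompact (convexHull ℝ (Set.range T.points)) :=
  (Set.finite_range _).isCompact_convexHull ℝ

lemma bary_le_one {x : E d} (hx : ∀ i, 0 ≤ bary T i x) (i : Fin (d + 1)) : bary T i x ≤ 1 := by
  rw [← sum_bary T x]
  exact Finset.single_le_sum (fun j _ => hx j) (Finset.mem_univ i)

/-- The zero set is a proper affine subspace, hence null. -/
lemma ae_bary_ne_zero (i : Fin (d + 1)) : ∀ᵐ x : E d, bary T i x ≠ 0 := by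
  let A : AffineSubspace ℝ (E d) :=
    { carrier := {x | bary T i x = 0}
      smul_vsub_vadd_mem' := by
        intro c p q r hp hq hr
        simp only [Set.mem_ofPred_eq] at *
        rw [vsub_eq_sub, vadd_eq_add, add_comm, bary_add, map_smul, bary_sub, hp, hq, hr]
        simp }
  have hA : A ≠ ⊤ := by
    intro h
    have : T.points i ∈ A := h ▸ AffineSubspace.mem_top ℝ (E d) _
    have h1 : bary T i (T.points i) = 0 := this
    simp [bary_points] at h1
  have h0 := Measure.addHaar_affineSubspace volume A hA
  rw [ae_iff]
  simpa using! h0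

/-- The restriction of a Bernstein monomial to the simplex, extended by zero. -/
def bernsteinOn (α : Fin (d + 1) → ℕ) : E d → ℝ :=
  (convexHull ℝ (Set.range T.points)).indicator (bernstein T α)

lemma integrable_bernsteinOn (α : Fin (d + 1) → ℕ) : Integrable (bernsteinOn T α) :=
  ((continuous_bernstein T α).continuousOn.integrableOn_compact
    (isCompact_simplex T)).integrable_indicator (isCompact_simplex T).measurableSet

/-- Extension by zero can jump only across faces with `α_i = 0`, and a displacement preserving those
`λ_i` crosses none of them. -/
lemma abs_bernsteinOn_sub_le (α : Fin (d + 1) → ℕ) (x y : E d)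
    (hxy : ∀ i, α i = 0 → bary T i x = bary T i y) :
    |bernsteinOn T α x - bernsteinOn T α y| ≤ ∑ i, α i * |bary T i x - bary T i y| := by
  have hnn : 0 ≤ ∑ i, α i * |bary T i x - bary T i y| :=
    Finset.sum_nonneg fun i _ => mul_nonneg (Nat.cast_nonneg _) (abs_nonneg _)
  -- Clamping each `λ_i` to `[0, 1]` reproduces the extended monomial wherever the `λ_i` with `α_i =
  -- 0` are nonnegative, and clamping is 1-Lipschitz.
  let cl : ℝ → ℝ := fun t => max 0 (min 1 t)
  have hcl : ∀ t, |cl t| ≤ 1 := by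
    intro t
    rw [abs_of_nonneg (le_max_left _ _)]
    exact max_le zero_le_one (min_le_left _ _)
  have hcl_sub : ∀ s t, |cl s - cl t| ≤ |s - t| := by
    intro s t
    refine (abs_max_sub_max_le_max _ _ _ _).trans (max_le (by simp) ?_)
    exact (abs_min_sub_min_le_max _ _ _ _).trans (max_le (by simp) le_rfl)
  have hG : ∀ z : E d, (∀ i, α i = 0 → 0 ≤ bary T i z) →
      bernsteinOn T α z = ∏ i, cl (bary T i z) ^ α i := by
    intro z hz
    by_cases hzT : z ∈ convexHull ℝ (Set.range T.points)
    · rw [bernsteinOn, Set.indicator_of_mem hzT, bernstein]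
      have hpos := (mem_simplex_iff T z).1 hzT
      refine Finset.prod_congr rfl fun i _ => ?_
      simp only [cl]
      rw [min_eq_right (bary_le_one T hpos i), max_eq_right (hpos i)]
    · rw [bernsteinOn, Set.indicator_of_notMem hzT]
      rw [mem_simplex_iff] at hzT
      push Not at hzT
      obtain ⟨i, hi⟩ := hzT
      have h0 : α i ≠ 0 := fun h => absurd (hz i h) (not_le.2 hi)
      refine (Finset.prod_eq_zero (Finset.mem_univ i) ?_).symm
      have : cl (bary T i z) = 0 := max_eq_left ((min_le_right _ _).trans hi.le)
      rw [this, zero_pow h0]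
  by_cases hA : ∀ i, α i = 0 → 0 ≤ bary T i x
  · rw [hG x hA, hG y fun i hi => hxy i hi ▸ hA i hi]
    refine (abs_prod_pow_sub_prod_pow_le _ _ _ _ (fun i => hcl _) (fun i => hcl _)).trans ?_
    exact Finset.sum_le_sum fun i _ => mul_le_mul_of_nonneg_left (hcl_sub _ _) (Nat.cast_nonneg _)
  · push Not at hA
    obtain ⟨i, hi, hlt⟩ := hA
    have h1 : x ∉ convexHull ℝ (Set.range T.points) := by
      rw [mem_simplex_iff]
      exact fun h => absurd (h i) (not_le.2 hlt)
    have h2 : y ∉ convexHull ℝ (Set.range T.points) := by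
      rw [mem_simplex_iff]
      exact fun h => absurd (h i) (not_le.2 (hxy i hi ▸ hlt))
    rw [bernsteinOn, Set.indicator_of_notMem h1, Set.indicator_of_notMem h2, sub_zero, abs_zero]
    exact hnn

lemma hasDerivAt_bernsteinOn (α : Fin (d + 1) → ℕ) (v x : E d) (hx : ∀ i, bary T i x ≠ 0) :
    HasDerivAt (fun t : ℝ => bernsteinOn T α (x + t • v))
      ((convexHull ℝ (Set.range T.points)).indicator
        (fun y => ∑ i, (α i * bernstein T (α - Pi.single i 1) y) * dbary T i v) x) 0 := by
  have hline : HasDerivAt (fun t : ℝ => x + t • v) v 0 := by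
    simpa using ((hasDerivAt_id (0 : ℝ)).smul_const v).const_add x
  have hcont : ∀ i, Tendsto (fun t : ℝ => bary T i (x + t • v)) (𝓝 0) (𝓝 (bary T i x)) := by
    intro i
    have : Continuous fun t : ℝ => bary T i (x + t • v) :=
      (continuous_bary T i).comp (by fun_prop)
    simpa using this.tendsto 0
  by_cases hxT : x ∈ convexHull ℝ (Set.range T.points)
  · rw [Set.indicator_of_mem hxT]
    have hpos : ∀ i, 0 < bary T i x := fun i =>
      lt_of_le_of_ne ((mem_simplex_iff T x).1 hxT i) (hx i).symm
    have hev : ∀ᶠ t : ℝ in 𝓝 0, ∀ i, 0 < bary T i (x + t • v) :=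
      eventually_all.2 fun i => (hcont i).eventually (lt_mem_nhds (hpos i))
    have h1 : HasDerivAt (fun t : ℝ => bernstein T α (x + t • v))
        (∑ i, (α i * bernstein T (α - Pi.single i 1) x) * dbary T i v) 0 := by
      have := hasFDerivAt_bernstein T α (x + (0 : ℝ) • v)
      have := this.comp_hasDerivAt (0 : ℝ) hline
      simpa using! this
    refine h1.congr_of_eventuallyEq (hev.mono fun t ht => ?_)
    exact Set.indicator_of_mem ((mem_simplex_iff T _).2 fun i => (ht i).le) _
  · rw [Set.indicator_of_notMem hxT]
    rw [mem_simplex_iff] at hxT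
    push Not at hxT
    obtain ⟨i, hi⟩ := hxT
    refine (hasDerivAt_const (0 : ℝ) (0 : ℝ)).congr_of_eventuallyEq
      (((hcont i).eventually (gt_mem_nhds hi)).mono fun t ht => ?_)
    refine Set.indicator_of_notMem (fun h => ?_) _
    exact absurd ((mem_simplex_iff T _).1 h i) (not_le.2 ht)

/-- The divergence theorem on the simplex for a constant vector field times a Bernstein
monomial, tangential at the faces where the monomial does not vanish. -/
lemma integral_sum_bernstein_mul_dbary (α : Fin (d + 1) → ℕ) (v : E d)
    (hv : ∀ i, α i = 0 → dbary T i v = 0) :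
    ∫ x in convexHull ℝ (Set.range T.points),
      ∑ i, (α i * bernstein T (α - Pi.single i 1) x) * dbary T i v = 0 := by
  set S := convexHull ℝ (Set.range T.points) with hS
  have hSm : MeasurableSet S := (isCompact_simplex T).measurableSet
  obtain ⟨R, hR⟩ := (isCompact_simplex T).isBounded.subset_closedBall 0
  set C : ℝ := ∑ i, α i * |dbary T i v| with hC
  have hC0 : 0 ≤ C :=
    Finset.sum_nonneg fun i _ => mul_nonneg (Nat.cast_nonneg _) (abs_nonneg _)
  -- Outside `B` no translate `x + t v` with `|t| < 1` reaches the simplex, so the constant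
  -- Lipschitz bound may be cut off to an integrable one.
  let B : Set (E d) := Metric.closedBall 0 (R + ‖v‖)
  have hcontD : Continuous fun y : E d =>
      ∑ i, (α i * bernstein T (α - Pi.single i 1) y) * dbary T i v :=
    continuous_finsetSum _ fun i _ =>
      (continuous_const.mul (continuous_bernstein T _)).mul continuous_const
  -- The integral of the translated extension does not depend on `t`; differentiating under the
  -- integral at `t = 0` gives the assertion.
  have key := hasDerivAt_integral_of_dominated_loc_of_lip (μ := (volume : Measure (E d)))
    (F := fun (t : ℝ) x => bernsteinOn T α (x + t • v)) (x₀ := 0) (s := Metric.ball 0 1)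
    (bound := B.indicator fun _ => C)
    (F' := S.indicator (fun y => ∑ i, (α i * bernstein T (α - Pi.single i 1) y) * dbary T i v))
    (Metric.ball_mem_nhds _ one_pos)
    (Eventually.of_forall fun t =>
      ((integrable_bernsteinOn T α).comp_add_right (t • v)).aestronglyMeasurable)
    ((integrable_bernsteinOn T α).comp_add_right ((0 : ℝ) • v))
    (hcontD.aestronglyMeasurable.indicator hSm)
    (Eventually.of_forall fun x => ?_) ?_ ?_
  · have h1 := key.2
    have h2 : (fun t : ℝ => ∫ x, bernsteinOn T α (x + t • v))
        = fun _ => ∫ x, bernsteinOn T α x := by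
      funext t
      exact integral_add_right_eq_self (bernsteinOn T α) (t • v)
    rw [h2] at h1
    have h3 := h1.unique (hasDerivAt_const (0 : ℝ) _)
    rwa [integral_indicator hSm] at h3
  · refine LipschitzOnWith.of_dist_le_mul fun s hs t ht => ?_
    rw [Real.dist_eq, Real.dist_eq]
    by_cases hx : x ∈ B
    · rw [Set.indicator_of_mem hx, Real.coe_nnabs, abs_of_nonneg hC0]
      refine (abs_bernsteinOn_sub_le T α _ _ fun i hi => ?_).trans (le_of_eq ?_)
      · rw [bary_add, bary_add, map_smul, map_smul, hv i hi, smul_zero, smul_zero]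
      · rw [hC, Finset.sum_mul]
        refine Finset.sum_congr rfl fun i _ => ?_
        rw [bary_add, bary_add, map_smul, map_smul, smul_eq_mul, smul_eq_mul,
          add_sub_add_left_eq_sub, ← sub_mul, abs_mul]
        ring
    · have hout : ∀ t ∈ Metric.ball (0 : ℝ) 1, bernsteinOn T α (x + t • v) = 0 := by
        intro t ht
        refine Set.indicator_of_notMem (fun h => hx ?_) _
        have h1 := hR h
        rw [mem_closedBall_zero_iff] at h1
        rw [mem_ball_zero_iff, Real.norm_eq_abs] at ht
        rw [mem_closedBall_zero_iff]
        have h2 : ‖t • v‖ ≤ ‖v‖ := by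
          rw [norm_smul, Real.norm_eq_abs]
          exact mul_le_of_le_one_left (norm_nonneg _) ht.le
        calc ‖x‖ = ‖(x + t • v) - t • v‖ := by rw [add_sub_cancel_right]
          _ ≤ ‖x + t • v‖ + ‖t • v‖ := norm_sub_le _ _
          _ ≤ R + ‖v‖ := add_le_add h1 h2
      rw [hout s hs, hout t ht, Set.indicator_of_notMem hx]
      simp
  · exact (integrable_indicator_iff Metric.isClosed_closedBall.measurableSet).2
      (integrableOn_const (isCompact_closedBall _ _).measure_lt_top.ne)
  · filter_upwards [ae_all_iff.2 fun i => ae_bary_ne_zero T i] with x hx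
    exact hasDerivAt_bernsteinOn T α v x hx

/-- The monomial is positive on the interior of the simplex, a nonempty open set because it contains
the barycenter. -/
lemma integral_bernstein_pos (α : Fin (d + 1) → ℕ) :
    0 < ∫ x in convexHull ℝ (Set.range T.points), bernstein T α x := by
  have hSm := (isCompact_simplex T).measurableSet
  rw [setIntegral_pos_iff_support_of_nonneg_ae]
  · have hopen : IsOpen {x : E d | ∀ i, 0 < bary T i x} := by
      simp only [Set.ofPred_forall]
      exact isOpen_iInter_of_finite fun i => isOpen_lt continuous_const (continuous_bary T i)
    obtain ⟨x, hx⟩ := exists_bary_eq T (w := fun _ => (1 : ℝ) / (d + 1)) (by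
      rw [Finset.sum_const, Finset.card_univ, Fintype.card_fin, nsmul_eq_mul]
      push_cast
      field_simp)
    have hne : {x : E d | ∀ i, 0 < bary T i x}.Nonempty :=
      ⟨x, fun i => by rw [hx]; positivity⟩
    refine (hopen.measure_pos volume hne).trans_le (measure_mono fun y hy => ⟨?_, ?_⟩)
    · exact (Finset.prod_pos fun i _ => pow_pos (hy i) _).ne'
    · exact (mem_simplex_iff T y).2 fun i => (hy i).le
  · refine (ae_restrict_mem hSm).mono fun x hx => ?_
    exact Finset.prod_nonneg fun i _ => pow_nonneg ((mem_simplex_iff T x).1 hx i) _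
  · exact (continuous_bernstein T α).continuousOn.integrableOn_compact (isCompact_simplex T)

end Integral

/-! ### Stokes' theorem and exactness for bubble forms. -/

section Exactness

open BubbleComplex.Poly

variable {d : ℕ} (T : Affine.Simplex ℝ (E d) d)

/-- The integral over the simplex in terms of the Bernstein coefficients. -/
def integralMap : Poly (Fin (d + 1)) (GForm (E d)) →ₗ[ℝ] ℝ :=
  Finsupp.lsum ℝ fun α => (∫ x in convexHull ℝ (Set.range T.points), bernstein T α x) •
    { toFun := fun a => a d (stdVec id)
      map_add' := fun _ _ => rfl
      map_smul' := fun _ _ => rfl }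

lemma integralMap_single (α : Fin (d + 1) → ℕ) (a : GForm (E d)) :
    integralMap T (Finsupp.single α a)
      = (∫ x in convexHull ℝ (Set.range T.points), bernstein T α x) * a d (stdVec id) := by
  rw [integralMap, Finsupp.lsum_single]
  rfl

lemma integrableOn_bernstein (α : Fin (d + 1) → ℕ) :
    IntegrableOn (bernstein T α) (convexHull ℝ (Set.range T.points)) :=
  (continuous_bernstein T α).continuousOn.integrableOn_compact (isCompact_simplex T)

lemma integral_evalForm (u : Poly (Fin (d + 1)) (GForm (E d))) :
    integral T (evalForm T d u) = integralMap T u := by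
  have h1 : ∀ x, evalForm T d u x (stdVec id)
      = ∑ α ∈ u.support, bernstein T α x * u α d (stdVec id) := by
    intro x
    rw [evalForm_apply]
    simp
  rw [integral]
  simp only [h1]
  rw [integral_finsetSum _ fun α _ => (integrableOn_bernstein T α).mul_const _,
    integralMap, Finsupp.lsum_apply, Finsupp.sum]
  refine Finset.sum_congr rfl fun α _ => ?_
  rw [integral_mul_const]
  rfl

/-- Contract the vanishing `(d + 1)`-form `ξ ∧ dx` with `u 0`. -/
lemma wedgeAlt_volContract_one {n : ℕ} (ξ : E (n + 1) →L[ℝ] ℝ) (h : 1 + n = n + 1)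
    (u : Fin 1 → E (n + 1)) : wedgeAlt ξ (volContract h u)
      = ξ (u 0) • volContract (Nat.zero_add (n + 1)) (fun l => l.elim0) := by
  have h0 : 0 + (n + 1) = n + 1 := Nat.zero_add _
  have h1 := curryLeft_volContract h0 h (fun l : Fin 0 => (l.elim0 : E (n + 1))) (u 0)
  have h2 : (Fin.snoc (fun l : Fin 0 => (l.elim0 : E (n + 1))) (u 0) : Fin 1 → E (n + 1)) = u := by
    funext l
    have hl : l = Fin.last 0 := Fin.ext (by omega)
    rw [hl, Fin.snoc_last]
    rfl
  rw [h2] at h1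
  have h3 := curryLeft_wedgeAlt_succ ξ
    (volContract h0 (fun l : Fin 0 => (l.elim0 : E (n + 1)))) (u 0)
  rw [h1, eq_zero_of_finrank_lt (by simp) (wedgeAlt ξ (volContract h0 _)),
    ContinuousAlternatingMap.curryLeft_zero] at h3
  rw [eq_comm, ← sub_eq_zero]
  exact h3.symm

/-- Stokes' theorem for bubble forms. -/
lemma integralMap_extD {n : ℕ} (T : Affine.Simplex ℝ (E (n + 1)) (n + 1)) {r : ℕ}
    {z : Poly (Fin (n + 1 + 1)) (GForm (E (n + 1)))}
    (hz : z ∈ tangential (dbaryWedge T) (inDegree (E (n + 1)) n) (r + 1)) :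
    integralMap T (extD (dbaryWedge T) z) = 0 := by
  have := map_mem_of_tangential (integralMap T ∘ₗ extD (dbaryWedge T)) ⊥ hz
    fun α a ha hα hw => ?_
  · exact this
  rw [Submodule.mem_bot, LinearMap.comp_apply, extD_single, map_sum]
  simp only [map_smul, integralMap_single, dbaryWedge, wedge_succ_apply, smul_eq_mul]
  obtain ⟨j, hj⟩ : ∃ j, α j ≠ 0 := by
    by_contra! h
    simp [h] at hα
  set A : Finset (Fin (n + 1 + 1)) := Finset.univ.filter fun i => α i = 0 with hA
  have hjA : j ∉ A := by simp [hA, hj]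
  have hcard : A.card < n + 1 + 1 := by
    simpa using Finset.card_lt_univ_of_notMem hjA
  have h1 : 1 + n = n + 1 := Nat.add_comm _ _
  -- The coefficient is a combination of `dx(u, ·)` with `u` tangent to the faces where `α_i = 0`,
  -- so Stokes reduces to the divergence theorem for the constant field `u`.
  have hmem := mem_contractSpan_of_wedge T (n + 1 - A.card) A hjA (by omega) h1 a ha
    (fun i hi => hw i (by simpa [hA] using hi))
  generalize a n = b at hmem
  induction hmem using Submodule.span_induction with
  | mem b hb =>
    obtain ⟨u, hu, rfl⟩ := hb
    have hI := integral_sum_bernstein_mul_dbary T α (u 0)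
      (fun i hi => hu 0 i (by simp [hA, hi]))
    rw [integral_finsetSum _ fun i _ =>
      ((integrableOn_bernstein T _).const_mul _).mul_const _] at hI
    simp only [integral_mul_const, integral_const_mul] at hI
    simp only [wedgeAlt_volContract_one, ContinuousAlternatingMap.smul_apply, smul_eq_mul,
      ← mul_assoc]
    rw [← Finset.sum_mul, hI, zero_mul]
  | zero =>
    refine Finset.sum_eq_zero fun i _ => ?_
    have : wedgeAlt (dbary T i) (0 : Alt (n + 1) n) = 0 := by
      simpa using wedgeAlt_smul 0 (dbary T i) (0 : Alt (n + 1) n)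
    rw [this]
    simp
  | add b c _ _ hb hc =>
    simp only [wedgeAlt_add, ContinuousAlternatingMap.add_apply, mul_add,
      Finset.sum_add_distrib, hb, hc, add_zero]
  | smul t b _ hb =>
    simp only [wedgeAlt_smul, ContinuousAlternatingMap.smul_apply, smul_eq_mul,
      mul_left_comm _ t]
    rw [← Finset.mul_sum, hb, mul_zero]

lemma dbaryWedge_eq_zero {a : GForm (E d)} (ha : a ∈ inDegree (E d) d) (i : Fin (d + 1)) :
    dbaryWedge T i a = 0 := by
  have h := wedge_mem_inDegree ha (dbary T i)
  rw [dbaryWedge, ← ofDegree_eq_self h, eq_zero_of_finrank_lt (by simp) (wedge (dbary T i) a (d + 1)),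
    map_zero]

lemma extD_mem {r k : ℕ} {u : Poly (Fin (d + 1)) (GForm (E d))}
    (hu : u ∈ tangential (dbaryWedge T) (inDegree (E d) k) (r + 1)) :
    extD (dbaryWedge T) u ∈ tangential (dbaryWedge T) (inDegree (E d) (k + 1)) r :=
  extD_mem_tangential (dbaryWedge_anticomm T) (fun _ _ ha => wedge_mem_inDegree ha _) hu

lemma extDeriv_zero_form {k : ℕ} : extDeriv (0 : Form d k) = 0 := by
  funext x
  simpa using extDeriv_smul (x := x) (0 : ℝ) (0 : Form d k)

lemma image_extDeriv_bot {k : ℕ} :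
    extDeriv '' ((⊥ : Submodule ℝ (Form d k)) : Set (Form d k)) = {0} := by
  simp [extDeriv_zero_form]

/-- The differential is injective on bubble functions. -/
lemma eq_zero_of_extDeriv_eq_zero {n : ℕ} (T : Affine.Simplex ℝ (E (n + 1)) (n + 1)) {s : ℤ}
    {ω : Form (n + 1) 0} (hω : ω ∈ bubble T s 0 (Nat.zero_le _)) (h : extDeriv ω = 0) :
    ω = 0 := by
  by_cases hs : s < ((n + 1 : ℕ) : ℤ) - (0 : ℕ) + 1
  · rw [bubble_eq_bot T _ hs] at hω
    exact hω
  lift s to ℕ using (by omega)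
  rw [bubble_eq_map T (by omega)] at hω
  obtain ⟨u, hu, rfl⟩ := hω
  have hfd : ∀ x, fderiv ℝ (evalForm T 0 u) x = 0 := by
    intro x
    ext w v
    have h1 := congrArg (fun η : Form (n + 1) 1 => η x (fun _ => w)) h
    simp only [extDeriv, ContinuousAlternatingMap.alternatizeUncurryFin_apply] at h1
    rw [Subsingleton.elim v (Fin.removeNth 0 fun _ => w)]
    simpa using h1
  have hconst := is_const_of_fderiv_eq_zero (differentiable_evalForm T 0 u) hfd
  funext x
  rw [hconst x (T.points 0), evalForm_apply]
  refine Finset.sum_eq_zero fun α hα => ?_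
  -- A 0-form killed by `dλ_1` is zero, so `λ_1` divides every monomial that occurs and the constant
  -- is read off as zero at `p_0`.
  have h1 : α 1 ≠ 0 := by
    intro h0
    refine Finsupp.mem_support_iff.1 hα ?_
    have h2 := contract_wedge (dbary T 1) (T.points 1 - T.points 0) (u α)
    have h3 : wedge (dbary T 1) (u α) = 0 := (hu α).2.2 1 h0
    have h4 : contract (T.points 1 - T.points 0) (u α) = 0 := by
      funext l
      rw [contract_apply, (hu α).1 (l + 1) (by omega)]
      rfl
    rw [h3, h4, map_zero, map_zero, sub_zero, dbary_edge] at h2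
    simpa using h2.symm
  have : bernstein T α (T.points 0) = 0 := by
    refine Finset.prod_eq_zero (Finset.mem_univ 1) ?_
    rw [bary_points, if_neg (by simp), zero_pow h1]
  rw [this, zero_smul]

/-- Exactness of the bubble complex at the forms of degree `k + 1 < d`. -/
lemma image_extDeriv_bubble {k : ℕ} (hk : k + 1 < d) {r r' : ℤ} (hr : r' = r + 1) :
    extDeriv '' (bubble T r' k (by omega) : Set (Form d k)) =
      {ω | ω ∈ bubble T r (k + 1) hk.le ∧ extDeriv ω = 0} := by
  subst hr
  by_cases hr0 : r ≤ 0
  · rw [bubble_eq_bot T _ (by push_cast; omega), bubble_eq_bot T _ (by push_cast; omega),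
      image_extDeriv_bot]
    ext ω
    simp only [Set.mem_singleton_iff, Submodule.mem_bot, Set.mem_ofPred_eq]
    refine ⟨?_, fun h => h.1⟩
    rintro rfl
    exact ⟨rfl, extDeriv_zero_form⟩
  lift r to ℕ using (by omega)
  -- Writing `r = q + 1` lets `extD` of the coefficients be tangential of degree `q`, as needed to
  -- recover `extD u = 0` from the vanishing form.
  obtain ⟨q, rfl⟩ : ∃ q, r = q + 1 := ⟨r - 1, by omega⟩
  have e : ((q + 1 : ℕ) : ℤ) + 1 = ((q + 1 + 1 : ℕ) : ℤ) := by push_cast; ring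
  rw [e, bubble_eq_map T (by omega), bubble_eq_map T (by omega)]
  ext ω
  constructor
  · rintro ⟨_, ⟨u, hu, rfl⟩, rfl⟩
    rw [extDeriv_evalForm]
    refine ⟨⟨_, extD_mem T hu, rfl⟩, ?_⟩
    rw [extDeriv_evalForm, extD_extD (dbaryWedge_anticomm T), map_zero]
  · rintro ⟨⟨u, hu, rfl⟩, hD⟩
    rw [extDeriv_evalForm] at hD
    obtain ⟨z, hz, hzu⟩ := exists_extD_dbaryWedge_eq T hu (evalForm_injOn T (extD_mem T hu) hD)
      (Or.inl hk.ne)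
    exact ⟨evalForm T k z, ⟨z, hz, rfl⟩, by rw [extDeriv_evalForm, hzu]⟩

/-- In top degree the conditions `dλ_i ∧ a = 0` hold automatically, so even a pure power of `λ_0` is
admissible. -/
lemma single_mem_tangential_top {r : ℕ} {a : GForm (E d)} (ha : a ∈ inDegree (E d) d) :
    Finsupp.single (Pi.single 0 r) a ∈ tangential (dbaryWedge T) (inDegree (E d) d) r :=
  single_mem_tangential ha (by simp) fun i _ => dbaryWedge_eq_zero T ha i

/-- Exactness of the bubble complex at the forms of top degree. -/
lemma image_extDeriv_bubble_top {n : ℕ} (T : Affine.Simplex ℝ (E (n + 1)) (n + 1)) {r r' : ℤ}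
    (hr : r' = r + 1) :
    extDeriv '' (bubble T r' n (Nat.le_succ n) : Set (Form (n + 1) n)) =
      {ω | ω ∈ bubble T r (n + 1) le_rfl ∧ integral T ω = 0} := by
  subst hr
  by_cases hr0 : r ≤ 0
  · rw [bubble_eq_bot T _ (by push_cast; omega), bubble_eq_bot T _ (by push_cast; omega),
      image_extDeriv_bot]
    ext ω
    simp only [Set.mem_singleton_iff, Submodule.mem_bot, Set.mem_ofPred_eq]
    refine ⟨?_, fun h => h.1⟩
    rintro rfl
    exact ⟨rfl, by simp [integral]⟩
  lift r to ℕ using (by omega)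
  have e : (r : ℤ) + 1 = ((r + 1 : ℕ) : ℤ) := by push_cast; ring
  rw [e, bubble_eq_map T (by omega), bubble_eq_map T (by omega)]
  ext ω
  constructor
  · rintro ⟨_, ⟨u, hu, rfl⟩, rfl⟩
    rw [extDeriv_evalForm]
    exact ⟨⟨_, extD_mem T hu, rfl⟩, by rw [integral_evalForm, integralMap_extD T hu]⟩
  · rintro ⟨⟨u, hu, rfl⟩, hI⟩
    rw [integral_evalForm] at hI
    have hfac : factSum u ∈ inDegree (E (n + 1)) (n + 1) :=
      map_mem_of_tangential factSum _ hu fun α a ha _ _ => by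
        rw [factSum_single]
        exact Submodule.smul_mem _ _ ha
    have hr1 : (r.factorial : ℝ) ≠ 0 := by positivity
    -- The factor `1 / r!` gives `b X_0^r` the same `factSum` as `u`, so the difference is exact.
    set b : GForm (E (n + 1)) := (r.factorial : ℝ)⁻¹ • factSum u with hb
    have hbdeg : b ∈ inDegree (E (n + 1)) (n + 1) := Submodule.smul_mem _ _ hfac
    set z₀ : Poly (Fin (n + 1 + 1)) (GForm (E (n + 1))) :=
      Finsupp.single (Pi.single 0 r) b with hz₀
    have hz₀mem := single_mem_tangential_top T (r := r) hbdeg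
    have hz₀fac : factSum z₀ = factSum u := by
      have : ∏ i, ((Pi.single 0 r : Fin (n + 1 + 1) → ℕ) i).factorial = r.factorial := by
        rw [Finset.prod_eq_single 0 (fun i _ hi => by simp [hi]) (by simp)]
        simp
      rw [hz₀, factSum_single, this, hb, smul_smul, mul_inv_cancel₀ hr1, one_smul]
    have hsub := Submodule.sub_mem _ hu hz₀mem
    obtain ⟨z, hz, hzu⟩ := exists_extD_dbaryWedge_eq T hsub (by
        rw [extD_apply]
        refine Finset.sum_eq_zero fun i _ => ?_
        have : map (dbaryWedge T i) (u - z₀) = 0 := by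
          ext1 α
          rw [map_apply, dbaryWedge_eq_zero T (hsub α).1, Finsupp.zero_apply]
        rw [← hz₀, this, map_zero])
      (Or.inr (by rw [← hz₀, map_sub, hz₀fac, sub_self]))
    -- Stokes applied to the exact difference, together with `∫ u = 0`, gives `∫ z₀ = 0`; positivity
    -- of the Bernstein integral then forces `b = 0`, and `u` itself is exact.
    have h0 : integralMap T z₀ = 0 := by
      have := integralMap_extD T hz
      rw [hzu, map_sub, hI, zero_sub, neg_eq_zero] at this
      exact this
    rw [hz₀, integralMap_single] at h0
    have hb0 := (mul_eq_zero.1 h0).resolve_left (integral_bernstein_pos T _).ne'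
    have hb1 : b = 0 := by
      rw [← ofDegree_eq_self hbdeg, eq_smul_volContract (Nat.zero_add _) (b (n + 1)), hb0,
        zero_smul, map_zero]
    rw [← hz₀, hz₀, hb1, Finsupp.single_zero, sub_zero] at hzu
    exact ⟨evalForm T n z, ⟨z, hz, rfl⟩, by rw [extDeriv_evalForm, hzu]⟩

lemma exists_integral_eq {r : ℤ} (hr : 0 < r) (c : ℝ) :
    ∃ ω ∈ bubble T r d le_rfl, integral T ω = c := by
  lift r to ℕ using hr.le
  rw [bubble_eq_map T (by omega)]
  set I := ∫ x in convexHull ℝ (Set.range T.points), bernstein T (Pi.single 0 r) x with hI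
  have hIpos : I ≠ 0 := (integral_bernstein_pos T _).ne'
  refine ⟨_, ⟨_, single_mem_tangential_top T (ofDegree_mem d ((I⁻¹ * c) •
    volContract (Nat.zero_add d) (fun l => l.elim0))), rfl⟩, ?_⟩
  rw [integral_evalForm, integralMap_single, ofDegree_same, ContinuousAlternatingMap.smul_apply,
    volContract_stdVec, smul_eq_mul, mul_one, mul_inv_cancel_left₀ hIpos]

end Exactness

end BubbleComplex

end

/-- The dimension is written `n + 1` to encode `d ≥ 1`. The inclusions from left to right in the set
equalities express that the sequence is a well-defined complex. -/
theorem proposition6p5 (n : ℕ)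
    (T : Affine.Simplex ℝ (BubbleComplex.E (n + 1)) (n + 1)) (s : ℤ) :
    (∀ ω ∈ BubbleComplex.bubble T s 0 (Nat.zero_le _), extDeriv ω = 0 → ω = 0) ∧
    (∀ (j : ℕ) (hj : j + 1 < n + 1),
      extDeriv '' (BubbleComplex.bubble T (s - j) j (by omega) :
          Set (BubbleComplex.Form (n + 1) j)) =
        {ω | ω ∈ BubbleComplex.bubble T (s - (j + 1)) (j + 1) hj.le ∧ extDeriv ω = 0}) ∧
    (extDeriv '' (BubbleComplex.bubble T (s - n) n (Nat.le_succ n) :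
          Set (BubbleComplex.Form (n + 1) n)) =
        {ω | ω ∈ BubbleComplex.bubble T (s - (n + 1)) (n + 1) le_rfl ∧
          BubbleComplex.integral T ω = 0}) ∧
    ((n : ℤ) + 1 < s → ∀ c : ℝ,
      ∃ ω ∈ BubbleComplex.bubble T (s - (n + 1)) (n + 1) le_rfl,
        BubbleComplex.integral T ω = c) :=
  ⟨fun _ hω h => BubbleComplex.eq_zero_of_extDeriv_eq_zero T hω h,
    fun _ hj => BubbleComplex.image_extDeriv_bubble T hj (by ring),
    BubbleComplex.image_extDeriv_bubble_top T (by ring),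
    fun hs c => BubbleComplex.exists_integral_eq T (by omega) c⟩
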